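/- **Model.** Fix $n\ge 1$. In an $n\times n$ input-queued switch, in each time slot $t=0,1,2,\dots$ there are queue lengths $\mathbf q(t)\in\mathbb Z_{\ge0}^{n\times n}$, a scheduling algorithm picks (possibly at random) a schedule $\mathbf s(t)$ in the set $\mathcal X$ of $n\times n$ permutation matrices, packets $\mathbf a(t)\in\mathbb Z_{\ge0}^{n\times n}$ arrive, and $q_{ij}(t+1)=\max\{0,\,q_{ij}(t)+a_{ij}(t)-s_{ij}(t)\}$. Let $\tilde{\mathcal H}_t=(\mathbf q(0),\mathbf s(0),\dots,\mathbf q(t),\mathbf s(t))$; $\mathbf a(t)$ is independent of $\tilde{\mathcal H}_t$. Write $\langle\mathbf x,\mathbf y\rangle=\sum_{i,j}x_{ij}y_{ij}$, with norm $\|\cdot\|$. The system depends on a parameter $\epsilon\in(0,1)$. *Arrivals.* For each $\epsilon$: for each pair $(i,j)$ the $a_{ij}(t)$ are i.i.d. in $t$; in each slot, $a_{ij}(t)$ and $a_{i'j'}(t)$ are independent for $(i,j)\ne(i',j')$; $a_{ij}(t)\le a_{\max}$ with $a_{\max}<\infty$ independent of $\epsilon$; and $\mathbb P(\mathbf a(t)=\mathbf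 0)>0$. Further, $\mathbb E[\mathbf a(t)]=(1-\epsilon)\boldsymbol\nu$ for a fixed doubly stochastic matrix $\boldsymbol\nu$ with all entries positive, and $\mathrm{Var}(a_{ij}(t))\to\tilde\sigma_{ij}^2$ as $\epsilon\downarrow0$ for all $i,j$. *State.* For each $\epsilon$ there is a time-homogeneous Markov chain $X(t)$ on a countable state space. Condition A.1: $X(t)$ is $\sigma(\tilde{\mathcal H}_t)$-measurable, irreducible and aperiodic. Condition A.2: there is a function $g$ with $\mathbf q(t)=g(X(t))$ such that $g^{-1}(A)$ is finite for every finite set $A$. The switch is *stable* if $X(t)$ is positive recurrent. $\bar{\mathbf q}$ denotes the limit in distribution of $\mathbf q(t)$ as $t\to\infty$. *Class $\Pi_2$.* The algorithm lies in $\Pi_2$ if for each $\epsilon$ the chain $X(t)$ satisfies A.1 and A.2, and there is a constant $W_2\ge0$, independent of $\epsilon$, such that for all $t\ge0$ and all states $x$ with $\mathbb P(X(t)=x)>0$, $$\mathbb E\big[\langle\mathbf q(t),\mathbf s(t)\rangle\,\big|\,X(t)=x\big]\ \ge\ \max_{\mathbf s\in\mathcal X}\langle g(x),\mathbf s\rangle-W_2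 .$$ *Cone.* Let $\mathcal K$ be the set of matrices with nonnegative entries in the linear span of the $2n$ matrices that have ones in one row, or in one column, and zeros elsewhere. Let $\mathbf x_{\perp\mathcal K}=\mathbf x-\mathbf x_{\|\mathcal K}$, where $\mathbf x_{\|\mathcal K}$ is the point of $\mathcal K$ nearest to $\mathbf x$. **Theorem.** Any scheduling algorithm in class $\Pi_2$ achieves state-space collapse, and its heavy-traffic behaviour is MaxWeight-like. That is: 1. (State-space collapse) for every $\epsilon\in(0,1)$ the chain $X(t)$ satisfies A.1 and A.2, the switch is stable, and $\mathbf q(t)$ converges in distribution to some $\bar{\mathbf q}$; and there are $\epsilon_0>0$ and constants $C_r<\infty$, independent of $\epsilon$, such that $$\mathbb E\big[\|\bar{\mathbf q}_{\perp\mathcal K}\|^r\big]\le C_r\qquad\text{for all } r\in\{1,2,\dots\}\text{ and all }\epsilon\in(0,1)\text{ with }\epsilon\le\epsilon_0 .$$ 2. (MaxWeight-like) $\mathbb E\big[\sum_{i,j}\bar q_{ij}\big]<\infty$ for every $\epsilon\in(0,1)$, and $$\lim_{\epsilon\downarrow0}\ \epsilon\,\mathbb E\Big[\sum_{i,j}\bar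 q_{ij}\Big]=\Big(1-\frac1{2n}\Big)\sum_{i,j}\tilde\sigma_{ij}^2 .$$ -/

import Mathlib

open MeasureTheory ProbabilityTheory Filter Topology
open scoped ENNReal

universe u v

namespace InputQueuedSwitch

/-! ### Matrices, schedules and weights -/

/-- `n × n` matrices of numbers of packets (with the product, i.e. discrete, topology). -/
abbrev PacketMatrix (n : ℕ) : Type := Fin n → Fin n → ℕ

/-- `ℝ^{n × n}` with the Frobenius inner product and norm. -/
abbrev RealMatrix (n : ℕ) : Type := EuclideanSpace ℝ (Fin n × Fin n)

/-- A packet matrix, seen in `ℝ^{n × n}`. -/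
noncomputable def toReal {n : ℕ} (q : PacketMatrix n) : RealMatrix n :=
  WithLp.toLp 2 fun p => (q p.1 p.2 : ℝ)

/-- The `0`-`1` matrix of the perfect matching that connects input `i` with output `σ i`. -/
def scheduleOf {n : ℕ} (σ : Equiv.Perm (Fin n)) : PacketMatrix n :=
  fun i j => if σ i = j then 1 else 0

/-- The set of possible schedules: all `n × n` permutation matrices. -/
def schedules (n : ℕ) : Set (PacketMatrix n) := Set.range scheduleOf

/-- The weight `⟨q, s⟩` of the schedule `s` at queue lengths `q`. -/
def weight {n : ℕ} (q s : PacketMatrix n) : ℕ := ∑ i, ∑ j, q i j * s i j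

/-- The largest weight of a schedule at queue lengths `q`. -/
def maxWeight {n : ℕ} (q : PacketMatrix n) : ℕ :=
  Finset.univ.sup fun σ : Equiv.Perm (Fin n) => weight q (scheduleOf σ)

/-! ### The cone of state-space collapse -/

/-- The matrix whose `i`-th row is all ones, with zeros elsewhere. -/
noncomputable def rowOnes {n : ℕ} (i : Fin n) : RealMatrix n :=
  WithLp.toLp 2 fun p => if p.1 = i then 1 else 0

/-- The matrix whose `j`-th column is all ones, with zeros elsewhere. -/
noncomputable def colOnes {n : ℕ} (j : Fin n) : RealMatrix n :=
  WithLp.toLp 2 fun p => if p.2 = j then 1 else 0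

/-- The subspace spanned by the row matrices and the column matrices. -/
noncomputable def collapseSpace (n : ℕ) : Submodule ℝ (RealMatrix n) :=
  Submodule.span ℝ (Set.range rowOnes ∪ Set.range colOnes)

/-- The cone `𝒦`: the intersection of `collapseSpace` with the nonnegative orthant. -/
def cone (n : ℕ) : Set (RealMatrix n) := {x | x ∈ collapseSpace n ∧ ∀ p, 0 ≤ x p}

theorem isClosed_cone (n : ℕ) : IsClosed (cone n) := by
  have h1 : IsClosed (collapseSpace n : Set (RealMatrix n)) :=
    Submodule.closed_of_finiteDimensional _
  have h2 : IsClosed {x : RealMatrix n | ∀ p, 0 ≤ x p} := by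
    simp only [Set.ofPred_forall]
    exact isClosed_iInter fun p => isClosed_le continuous_const (by fun_prop)
  exact h1.inter h2

theorem zero_mem_cone (n : ℕ) : (0 : RealMatrix n) ∈ cone n :=
  ⟨Submodule.zero_mem _, fun p => by simp⟩

/-- The cone has a point nearest to `x`. -/
theorem exists_nearest {n : ℕ} (x : RealMatrix n) :
    ∃ p ∈ cone n, ∀ y ∈ cone n, ‖x - p‖ ≤ ‖x - y‖ := by
  obtain ⟨p, hp, h⟩ := (isClosed_cone n).exists_infDist_eq_dist ⟨0, zero_mem_cone n⟩ x
  refine ⟨p, hp, fun y hy => ?_⟩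
  rw [← dist_eq_norm, ← dist_eq_norm, ← h]
  exact Metric.infDist_le_dist_of_mem hy

/-- The projection `x_{∥𝒦}` of `x` onto the cone: its (unique) nearest point in the cone. -/
noncomputable def projCone {n : ℕ} (x : RealMatrix n) : RealMatrix n :=
  (exists_nearest x).choose

/-- `x_{⊥𝒦} = x - x_{∥𝒦}`. -/
noncomputable def perpCone {n : ℕ} (x : RealMatrix n) : RealMatrix n := x - projCone x

/-! ### Countable Markov chains -/

section Chain

variable {S : Type v}

open Classical in
/-- The `k`-step transition probabilities of the transition matrix `P`. -/
noncomputable def stepProb (P : S → PMF S) : ℕ → S → S → ℝ≥0∞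
  | 0, x, y => if x = y then 1 else 0
  | k + 1, x, y => ∑' z, P x z * stepProb P k z y

/-- Every state can be reached from every state. -/
def Irreducible (P : S → PMF S) : Prop := ∀ x y, ∃ k, 0 < stepProb P k x y

/-- For every state, the possible return times have greatest common divisor `1`. -/
def Aperiodic (P : S → PMF S) : Prop :=
  ∀ x, ∀ d : ℕ, (∀ k, 1 ≤ k → 0 < stepProb P k x x → d ∣ k) → d = 1

open Classical in
/-- `firstPassage P x k y` is the probability that the chain started at `y` is at `x` at time `k`,
for the first time among the times `1, 2, …, k`. -/
noncomputable def firstPassage (P : S → PMF S) (x : S) : ℕ → S → ℝ≥0∞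
  | 0, _ => 0
  | 1, y => P y x
  | k + 2, y => ∑' z, if z = x then 0 else P y z * firstPassage P x (k + 1) z

/-- From every state the chain returns with probability one, and the mean return time is finite. -/
def PositiveRecurrent (P : S → PMF S) : Prop :=
  ∀ x, ∑' k, firstPassage P x k x = 1 ∧ ∑' k : ℕ, (k : ℝ≥0∞) * firstPassage P x k x < ∞

end Chain

/-! ### The switch -/

/-- The σ-algebra generated by the history `q(0), s(0), …, q(t), s(t)`. -/
abbrev historyOf {Ω : Type u} {n : ℕ} (q s : ℕ → Ω → PacketMatrix n) (t : ℕ) :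
    MeasurableSpace Ω :=
  (⨆ k ∈ Set.Iic t, MeasurableSpace.comap (q k) inferInstance) ⊔
    ⨆ k ∈ Set.Iic t, MeasurableSpace.comap (s k) inferInstance

/-- The processes of an `n × n` input-queued switch that is run by a scheduling algorithm: in slot
`t` there are queue lengths `q t`, the algorithm picks a schedule `s t`, and packets `a t` arrive.
The algorithm may use the past and additional randomness, and cannot foresee the arrivals. -/
structure SwitchSystem (n : ℕ) where
  Ω : Type u
  mΩ : MeasurableSpace Ω
  μ : Measure Ω
  isProb : IsProbabilityMeasure μ
  a : ℕ → Ω → PacketMatrix n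
  s : ℕ → Ω → PacketMatrix n
  q : ℕ → Ω → PacketMatrix n
  measurable_a : ∀ t, Measurable (a t)
  measurable_s : ∀ t, Measurable (s t)
  measurable_q : ∀ t, Measurable (q t)
  s_mem : ∀ t ω, s t ω ∈ schedules n
  /-- `q(t+1) = [q(t) + a(t) - s(t)]⁺`. -/
  q_succ : ∀ t ω i j, (q (t + 1) ω i j : ℤ) = max 0 ((q t ω i j : ℤ) + a t ω i j - s t ω i j)
  /-- The arrivals of slot `t` are independent of `q(0), s(0), …, q(t), s(t)`. -/
  indep_history : ∀ t,
    Indep (historyOf q s t) (MeasurableSpace.comap (a t) inferInstance) μ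

attribute [instance] SwitchSystem.mΩ SwitchSystem.isProb

namespace SwitchSystem

variable {n : ℕ} (M : SwitchSystem.{u} n)

/-- The assumptions on the arrivals. -/
structure ArrivalAssumption (amax : ℕ) : Prop where
  indep_time : ∀ i j, iIndepFun (fun t ω => M.a t ω i j) M.μ
  identDistrib : ∀ i j t, IdentDistrib (fun ω => M.a t ω i j) (fun ω => M.a 0 ω i j) M.μ M.μ
  indep_pair : ∀ t i j i' j', (i, j) ≠ (i', j') →
    IndepFun (fun ω => M.a t ω i j) (fun ω => M.a t ω i' j') M.μ
  bounded : ∀ t ω i j, M.a t ω i j ≤ amax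
  zero_pos : ∀ t, 0 < M.μ {ω | M.a t ω = 0}

/-- The mean arrival rate of the pair `(i, j)` (the arrivals are identically distributed in time,
so slot `0` is used). -/
noncomputable def arrivalRate (i j : Fin n) : ℝ := ∫ ω, (M.a 0 ω i j : ℝ) ∂M.μ

/-- The variance of the arrivals of the pair `(i, j)` in a slot. -/
noncomputable def arrivalVariance (i j : Fin n) : ℝ :=
  variance (fun ω => (M.a 0 ω i j : ℝ)) M.μ

/-- `Q` is the law of the steady-state queue lengths: `q(t)` converges in distribution to it. -/
def IsSteadyState (Q : ProbabilityMeasure (PacketMatrix n)) : Prop :=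
  TendstoInDistribution M.q atTop id (fun _ => M.μ) (Q : Measure (PacketMatrix n))

/-- A process `X` on the switch that is a time-homogeneous Markov chain on a countable state space
`S` with transition matrix `P`. -/
structure StateChain where
  S : Type v
  countable : Countable S
  X : ℕ → M.Ω → S
  measurableSet_eq : ∀ t x, MeasurableSet {ω | X t ω = x}
  P : S → PMF S
  markov : ∀ (t : ℕ) (x : ℕ → S) (y : S),
    M.μ {ω | (∀ k ≤ t, X k ω = x k) ∧ X (t + 1) ω = y} =
      M.μ {ω | ∀ k ≤ t, X k ω = x k} * P (x t) y

namespace StateChain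

variable {M} (Y : StateChain.{u, v} M)

/-- The switch is stable: the Markov chain is positive recurrent. -/
def Stable : Prop := PositiveRecurrent Y.P

/-- Condition A.1: `X t` is measurable with respect to the history `q(0), s(0), …, q(t), s(t)`,
and the chain is irreducible and aperiodic. -/
def CondA1 : Prop :=
  (∀ t, Measurable[historyOf M.q M.s t, ⊤] (Y.X t)) ∧ Irreducible Y.P ∧ Aperiodic Y.P

/-- Condition A.2: `q t = g (X t)`, and preimages of finite sets under `g` are finite. -/
def CondA2 (g : Y.S → PacketMatrix n) : Prop :=
  (∀ t ω, M.q t ω = g (Y.X t ω)) ∧ ∀ A : Set (PacketMatrix n), A.Finite → (g ⁻¹' A).Finite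

/-- `E[⟨q(t), s(t)⟩ | X(t) = x] ≥ max_s ⟨g x, s⟩ - W` in all slots `t` and for all states `x` that
have positive probability in slot `t`. -/
def NearMaxWeight (g : Y.S → PacketMatrix n) (W : ℝ) : Prop :=
  ∀ t x, M.μ {ω | Y.X t ω = x} ≠ 0 →
    (maxWeight (g x) : ℝ) - W ≤
      ∫ ω, (weight (M.q t ω) (M.s t ω) : ℝ) ∂(ProbabilityTheory.cond M.μ {ω | Y.X t ω = x})

end StateChain

end SwitchSystem

/-! ### Families of switches indexed by the heavy-traffic parameter -/

/-- The values of the heavy-traffic parameter `ε`. -/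
abbrev Param : Type := Set.Ioo (0 : ℝ) 1

/-- The filter `ε ↓ 0`. -/
def heavyTraffic : Filter Param := comap Subtype.val (𝓝[>] (0 : ℝ))

variable {n : ℕ}

/-- The class `Π₂`. The constant `W` does not depend on `ε`. -/
def ClassTwo (M : Param → SwitchSystem.{u} n)
    (Y : ∀ ε, SwitchSystem.StateChain.{u, v} (M ε)) : Prop :=
  ∃ W : ℝ, 0 ≤ W ∧ ∀ ε, (Y ε).CondA1 ∧ ∃ g, (Y ε).CondA2 g ∧ (Y ε).NearMaxWeight g W

/-- State-space collapse. The constants `C r` do not depend on `ε`. -/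
def AchievesSSC (M : Param → SwitchSystem.{u} n)
    (Y : ∀ ε, SwitchSystem.StateChain.{u, v} (M ε)) : Prop :=
  (∀ ε, (Y ε).Stable) ∧ (∀ ε, (Y ε).CondA1 ∧ ∃ g, (Y ε).CondA2 g) ∧
  ∃ Q : Param → ProbabilityMeasure (PacketMatrix n),
    (∀ ε, (M ε).IsSteadyState (Q ε)) ∧
    ∃ ε₀ : ℝ, 0 < ε₀ ∧ ∃ C : ℕ → ℝ, ∀ ε : Param, (ε : ℝ) ≤ ε₀ → ∀ r : ℕ, 1 ≤ r →
      Integrable (fun q => ‖perpCone (toReal q)‖ ^ r) (Q ε : Measure (PacketMatrix n)) ∧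
      ∫ q, ‖perpCone (toReal q)‖ ^ r ∂(Q ε : Measure (PacketMatrix n)) ≤ C r

/-- MaxWeight-like heavy-traffic behaviour, where `σsq` is the matrix of the limits of the arrival
variances: `lim ε E[∑ q̄ᵢⱼ] = (1 - 1/(2n)) ∑ σsqᵢⱼ` as `ε ↓ 0`. -/
def MaxWeightLike (M : Param → SwitchSystem.{u} n) (σsq : Fin n → Fin n → ℝ) : Prop :=
  ∃ Q : Param → ProbabilityMeasure (PacketMatrix n),
    (∀ ε, (M ε).IsSteadyState (Q ε)) ∧
    (∀ ε, Integrable (fun q => ∑ i, ∑ j, (q i j : ℝ)) (Q ε : Measure (PacketMatrix n))) ∧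
    Tendsto
      (fun ε : Param =>
        (ε : ℝ) * ∫ q, (∑ i, ∑ j, (q i j : ℝ)) ∂(Q ε : Measure (PacketMatrix n)))
      heavyTraffic (𝓝 ((1 - 1 / (2 * (n : ℝ))) * ∑ i, ∑ j, σsq i j))

end InputQueuedSwitch

/-! The proof follows the mean change in one slot of three quadratic functions of the queue lengths
`q`. Let `δ > 0` be the least entry of `ν`.

Stability comes from `‖q‖²`. The largest weight is at least `⟨q, ν⟩` by Birkhoff's theorem, the
schedule attains it up to `W` in the mean, and the arrivals contribute only `(1 - ε)⟨q, ν⟩`. So the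
drift is at most `-2εδ‖q‖` plus a constant. Since increments are bounded, `exists_exp_drift` turns
this into a geometric drift of `exp (θ‖q‖)`, whose sublevel sets are finite by A.2. With
irreducibility and aperiodicity, a power of the transition matrix contracts a weighted distance
(`exists_coupledDist_le`). Hence the transition probabilities converge to a stationary law with
exponential moments, and a last-visit decomposition gives positive recurrence.

Collapse comes from `‖q_⊥‖²`, where `q_⊥` is the part of `q` off the cone. It lies in the polar
cone, so moving `ν` by `δ` in its direction gives a doubly substochastic matrix. The largest weight
therefore exceeds `⟨q, ν⟩` by `δ‖q_⊥‖` (`inner_add_mul_norm_perpCone_le_maxWeight`). Schedules and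
`ν` pair equally with the collapse space, so the part of `q` in the cone cancels. For small `ε` the
drift is at most `-δ‖q_⊥‖` plus a constant, with constants free of `ε`, and so are the resulting
exponential moments.

The limit comes from `‖Πq‖²`, with `Π` the orthogonal projection onto the collapse space. Its drift
is `-2ε (∑ q)/n + (2n-1)/n² ∑ var + ε²`, up to an error due to unused service, and it has mean zero
in steady state. The unused service has mean total `nε` and is orthogonal to the next queue, so it
meets only the component `q - Πq`, whose second moment is bounded by collapse. Young's inequality
with weight `√ε` makes the error `O(√ε)`, and multiplying by `n/2` gives the factor `1 - 1/(2n)`. -/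

namespace InputQueuedSwitch

open scoped NNReal

/-! ### Countable chains: drift, convergence, positive recurrence. -/

section MarkovChains

variable {S : Type v}

/-- The action of a nonnegative kernel on functions. -/
noncomputable def kernelAct (K : S → S → ℝ≥0∞) (f : S → ℝ≥0∞) (x : S) : ℝ≥0∞ :=
  ∑' y, K x y * f y

theorem kernelAct_mono (K : S → S → ℝ≥0∞) {f h : S → ℝ≥0∞} (hfh : ∀ x, f x ≤ h x) (x : S) :
    kernelAct K f x ≤ kernelAct K h x :=
  ENNReal.tsum_le_tsum fun y => by gcongr; exact hfh y

theorem kernelAct_add (K : S → S → ℝ≥0∞) (f h : S → ℝ≥0∞) (x : S) :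
    kernelAct K (fun y => f y + h y) x = kernelAct K f x + kernelAct K h x := by
  simp only [kernelAct, mul_add, ENNReal.tsum_add]

theorem kernelAct_const_mul (K : S → S → ℝ≥0∞) (c : ℝ≥0∞) (f : S → ℝ≥0∞) (x : S) :
    kernelAct K (fun y => c * f y) x = c * kernelAct K f x := by
  simp only [kernelAct, ← ENNReal.tsum_mul_left]
  exact tsum_congr fun y => by ring

theorem kernelAct_const {K : S → S → ℝ≥0∞} (hK : ∀ x, ∑' y, K x y = 1) (c : ℝ≥0∞) (x : S) :
    kernelAct K (fun _ => c) x = c := by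
  simp only [kernelAct, ENNReal.tsum_mul_right, hK, one_mul]

theorem kernelAct_ite [DecidableEq S] (K : S → S → ℝ≥0∞) (x z : S) :
    kernelAct K (fun y => if y = z then 1 else 0) x = K x z := by
  simp [kernelAct]

theorem kernelAct_stepProb_zero (P : S → PMF S) (f : S → ℝ≥0∞) (x : S) :
    kernelAct (stepProb P 0) f x = f x := by
  classical
  simp [kernelAct, stepProb]

theorem kernelAct_stepProb_succ (P : S → PMF S) (k : ℕ) (f : S → ℝ≥0∞) (x : S) :
    kernelAct (stepProb P (k + 1)) f x
      = kernelAct (fun a b => P a b) (kernelAct (stepProb P k) f) x := by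
  simp only [kernelAct, stepProb, ← ENNReal.tsum_mul_left, ← ENNReal.tsum_mul_right]
  rw [ENNReal.tsum_comm]
  exact tsum_congr fun y => tsum_congr fun z => by ring

theorem kernelAct_stepProb_add (P : S → PMF S) (j k : ℕ) (f : S → ℝ≥0∞) (x : S) :
    kernelAct (stepProb P (j + k)) f x
      = kernelAct (stepProb P j) (kernelAct (stepProb P k) f) x := by
  induction j generalizing x with
  | zero => rw [zero_add, kernelAct_stepProb_zero]
  | succ j ih =>
    rw [show j + 1 + k = (j + k) + 1 by ring, kernelAct_stepProb_succ, kernelAct_stepProb_succ]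
    exact tsum_congr fun y => by rw [ih]

theorem stepProb_add (P : S → PMF S) (j k : ℕ) (x y : S) :
    stepProb P (j + k) x y = ∑' z, stepProb P j x z * stepProb P k z y := by
  classical
  have h := kernelAct_stepProb_add P j k (fun z => if z = y then 1 else 0) x
  rw [kernelAct_ite] at h
  rw [h]
  exact tsum_congr fun z => by rw [kernelAct_ite]

theorem stepProb_one (P : S → PMF S) (x y : S) : stepProb P 1 x y = P x y := by
  classical
  simp [stepProb]

theorem tsum_stepProb (P : S → PMF S) (k : ℕ) (x : S) : ∑' y, stepProb P k x y = 1 := by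
  induction k generalizing x with
  | zero => classical simp [stepProb]
  | succ k ih =>
    simp only [stepProb]
    rw [ENNReal.tsum_comm]
    simp only [ENNReal.tsum_mul_left, ih, mul_one]
    exact (P x).tsum_coe

theorem stepProb_le_one (P : S → PMF S) (k : ℕ) (x y : S) : stepProb P k x y ≤ 1 :=
  (ENNReal.le_tsum y).trans (tsum_stepProb P k x).le

theorem mul_le_stepProb_add (P : S → PMF S) (j k : ℕ) (x y z : S) :
    stepProb P j x z * stepProb P k z y ≤ stepProb P (j + k) x y := by
  rw [stepProb_add]
  exact ENNReal.le_tsum z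

/-- A function satisfies the geometric drift inequality `P f ≤ γ f + b`. -/
def GeometricDrift (P : S → PMF S) (f : S → ℝ≥0) (γ b : ℝ≥0) : Prop :=
  ∀ x, kernelAct (fun a c => P a c) (fun y => (f y : ℝ≥0∞)) x ≤ γ * f x + b

theorem GeometricDrift.stepProb_le {P : S → PMF S} {f : S → ℝ≥0} {γ b : ℝ≥0}
    (h : GeometricDrift P f γ b) {L : ℝ≥0} (hL : γ * L + b ≤ L) (k : ℕ) (x : S) :
    kernelAct (stepProb P k) (fun y => (f y : ℝ≥0∞)) x ≤ (γ : ℝ≥0∞) ^ k * f x + L := by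
  induction k with
  | zero => rw [kernelAct_stepProb_zero]; simp
  | succ k ih =>
    have h1 : ∀ y, kernelAct (stepProb P 1) (fun y => (f y : ℝ≥0∞)) y ≤ γ * f y + b := fun y => by
      simpa only [kernelAct, stepProb_one] using h y
    rw [kernelAct_stepProb_add]
    calc _ ≤ kernelAct (stepProb P k) (fun y => (γ : ℝ≥0∞) * f y + b) x := kernelAct_mono _ h1 x
      _ = γ * kernelAct (stepProb P k) (fun y => (f y : ℝ≥0∞)) x + b := by
          rw [kernelAct_add, kernelAct_const_mul, kernelAct_const (tsum_stepProb P k)]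
      _ ≤ γ * ((γ : ℝ≥0∞) ^ k * f x + L) + b := by gcongr
      _ = (γ : ℝ≥0∞) ^ (k + 1) * f x + (γ * L + b) := by ring
      _ ≤ _ := by gcongr; exact_mod_cast hL

/-! #### Contraction in a weighted distance -/

open Classical in
/-- The weighted discrete distance `1_{x ≠ y} (2 + β V x + β V y)`. -/
noncomputable def weightedDist (V : S → ℝ≥0) (β : ℝ≥0) (x y : S) : ℝ≥0∞ :=
  if x = y then 0 else 2 + β * (V x + V y)

theorem weightedDist_le (V : S → ℝ≥0) (β : ℝ≥0) (x y : S) :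
    weightedDist V β x y ≤ 2 + β * (V x + V y) := by
  unfold weightedDist; split_ifs <;> simp

/-- The mean distance after one step of two independent copies of the chain `K`. -/
noncomputable def coupledDist (K : S → S → ℝ≥0∞) (d : S → S → ℝ≥0∞) (x y : S) : ℝ≥0∞ :=
  kernelAct K (fun u => kernelAct K (fun v => d u v) y) x

/-- The pointwise Lipschitz bound is integrated against the product of the two one-step laws, that
is, against independent copies. -/
theorem kernelAct_le_add_of_le_add {K : S → S → ℝ≥0∞} (hK : ∀ x, ∑' y, K x y = 1)
    {d : S → S → ℝ≥0∞} {φ : S → ℝ≥0∞} {c : ℝ≥0∞} (h : ∀ x y, φ x ≤ φ y + c * d x y) (x y : S) :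
    kernelAct K φ x ≤ kernelAct K φ y + c * coupledDist K d x y := by
  have h1 : ∀ u, φ u ≤ kernelAct K φ y + c * kernelAct K (fun v => d u v) y := fun u => by
    rw [← kernelAct_const_mul, ← kernelAct_add, ← kernelAct_const hK (φ u) y]
    exact kernelAct_mono _ (h u) y
  calc _ ≤ _ := kernelAct_mono _ h1 x
    _ = _ := by rw [kernelAct_add, kernelAct_const hK, kernelAct_const_mul]; rfl

theorem coupledDist_mono (K : S → S → ℝ≥0∞) {d d' : S → S → ℝ≥0∞} (h : ∀ x y, d x y ≤ d' x y)
    (x y : S) : coupledDist K d x y ≤ coupledDist K d' x y :=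
  kernelAct_mono _ (fun u => kernelAct_mono _ (h u) y) x

theorem coupledDist_affine {K : S → S → ℝ≥0∞} (hK : ∀ x, ∑' y, K x y = 1) (V : S → ℝ≥0)
    (β : ℝ≥0) (x y : S) :
    coupledDist K (fun u v => 2 + β * (V u + V v)) x y
      = 2 + β * (kernelAct K (fun u => (V u : ℝ≥0∞)) x
          + kernelAct K (fun u => (V u : ℝ≥0∞)) y) := by
  unfold coupledDist
  simp only [kernelAct_add, kernelAct_const_mul, kernelAct_const hK]

/-- The distance never exceeds its affine bound, and falls short of it by at least `2` when both
copies sit at `z`, which has probability `K x z * K y z`. -/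
theorem coupledDist_weightedDist_add_le {K : S → S → ℝ≥0∞} (hK : ∀ x, ∑' y, K x y = 1)
    (V : S → ℝ≥0) (β : ℝ≥0) (x y z : S) :
    coupledDist K (weightedDist V β) x y + K x z * K y z * 2
      ≤ 2 + β * (kernelAct K (fun u => (V u : ℝ≥0∞)) x
          + kernelAct K (fun u => (V u : ℝ≥0∞)) y) := by
  classical
  rw [← coupledDist_affine hK]
  have h2 : K x z * K y z * 2
      = coupledDist K (fun u v => (if u = z then 1 else 0) * (2 * if v = z then 1 else 0)) x y := by
    unfold coupledDist
    simp only [kernelAct_const_mul, kernelAct_ite]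
    have : (fun u => (if u = z then (1 : ℝ≥0∞) else 0) * (2 * K y z))
        = fun u => (2 * K y z) * (if u = z then (1 : ℝ≥0∞) else 0) := by
      funext u; ring
    rw [this, kernelAct_const_mul, kernelAct_ite]; ring
  have h3 : coupledDist K (weightedDist V β) x y + K x z * K y z * 2
      = coupledDist K (fun u v => weightedDist V β u v
          + (if u = z then 1 else 0) * (2 * if v = z then 1 else 0)) x y := by
    rw [h2]; unfold coupledDist; simp only [kernelAct_add]
  rw [h3]
  refine coupledDist_mono _ (fun u v => ?_) x y
  by_cases hu : u = z
  · by_cases hv : v = z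
    · simp [hu, hv, weightedDist]
    · simpa [hv] using weightedDist_le V β u v
  · simpa [hu] using weightedDist_le V β u v

/-- Here `s` plays the role of `V x + V y`. For large `s` the drift alone contracts. For small `s`
the gain `2α²` from meeting pays for the drift constant, provided that `β` is small. -/
theorem contraction_constants {γ b α R : ℝ} (hγ : γ < 1) (hγ0 : 0 ≤ γ) (hb : 0 ≤ b)
    (hα : 0 < α) (hR : R * (1 - γ) = 4 * b + 1) :
    ∃ β ρ : ℝ, 0 ≤ β ∧ 0 ≤ ρ ∧ ρ < 1 ∧
      (∀ s, R ≤ s → 2 + β * (γ * s + 2 * b) ≤ ρ * (2 + β * s)) ∧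
      ∀ s, 0 ≤ s → 2 + β * (γ * s + 2 * b) ≤ ρ * (2 + β * s) + α * α * 2 := by
  have hγ' : 0 < 1 - γ := by linarith
  set β : ℝ := α * α / (2 * b + 1) with hβdef
  have hβ : 0 < β := by positivity
  have hβb : β * (2 * b) ≤ α * α := by
    have : β * (2 * b + 1) = α * α := by rw [hβdef]; field_simp
    linarith
  -- With `ρ = 1 - κ`, one has to absorb `2κ + κβs + 2bβ` in `β(1-γ)s`. For `s ≥ R` the three
  -- summands take at most a quarter, a quarter and a half of it, the last because `R(1-γ) ≥ 4b`.
  -- For small `s`, both `2κ` and `2bβ` are at most `α²`.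
  set κ : ℝ := min (α * α / 2) (min ((1 - γ) / 4) (β * (1 - γ) * R / 8)) with hκdef
  have hκ1 : κ ≤ α * α / 2 := min_le_left _ _
  have hκ2 : κ ≤ (1 - γ) / 4 := (min_le_right _ _).trans (min_le_left _ _)
  have hκ3 : κ ≤ β * (1 - γ) * R / 8 := (min_le_right _ _).trans (min_le_right _ _)
  have hRβ : β * (1 - γ) * R = β * (4 * b + 1) := by rw [← hR]; ring
  have hκ : 0 < κ := by
    refine lt_min (by positivity) (lt_min (by positivity) ?_)
    rw [hRβ]; positivity
  have hRpos : 0 ≤ R := by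
    by_contra hneg
    nlinarith
  refine ⟨β, 1 - κ, hβ.le, by linarith, by linarith, fun s hs => ?_, fun s hs => ?_⟩
  · have h1 : κ * (β * s) ≤ (1 - γ) / 4 * (β * s) := by
      have : 0 ≤ β * s := mul_nonneg hβ.le (hRpos.trans hs)
      gcongr
    have h2 : β * (1 - γ) * R ≤ β * (1 - γ) * s := by gcongr
    nlinarith
  · have h1 : κ * (β * s) ≤ (1 - γ) * (β * s) := by
      have : 0 ≤ β * s := mul_nonneg hβ.le hs
      gcongr; linarith
    nlinarith

/-- A geometric drift inequality together with a minorization on a sublevel set makes the kernel a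
contraction for a weighted distance. -/
theorem exists_coupledDist_le {K : S → S → ℝ≥0∞} (hK : ∀ x, ∑' y, K x y = 1) {V : S → ℝ≥0}
    {γ b α R : ℝ≥0} (hγ : γ < 1) (hα : 0 < α) (hR : R * (1 - (γ : ℝ)) = 4 * b + 1)
    (hV : ∀ x, kernelAct K (fun y => (V y : ℝ≥0∞)) x ≤ γ * V x + b) {z : S}
    (hz : ∀ x, V x ≤ R → (α : ℝ≥0∞) ≤ K x z) :
    ∃ β ρ : ℝ≥0, ρ < 1 ∧ ∀ x y, x ≠ y →
      coupledDist K (weightedDist V β) x y ≤ ρ * weightedDist V β x y := by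
  obtain ⟨β, ρ, hβ, hρ0, hρ, h1, h2⟩ := contraction_constants (γ := γ) (b := b) (α := α) (R := R)
    (by exact_mod_cast hγ) γ.2 b.2 (by exact_mod_cast hα) hR
  lift β to ℝ≥0 using hβ
  lift ρ to ℝ≥0 using hρ0
  refine ⟨β, ρ, by exact_mod_cast hρ, fun x y hxy => ?_⟩
  have hd : weightedDist V β x y = 2 + β * (V x + V y) := by simp [weightedDist, hxy]
  have hb : 2 + β * (kernelAct K (fun u => (V u : ℝ≥0∞)) x
      + kernelAct K (fun u => (V u : ℝ≥0∞)) y) ≤ 2 + β * (γ * (V x + V y) + 2 * b) := by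
    calc _ ≤ (2 : ℝ≥0∞) + β * ((γ * V x + b) + (γ * V y + b)) := by gcongr <;> exact hV _
      _ = _ := by ring
  have hmain := (coupledDist_weightedDist_add_le hK V β x y z).trans hb
  rw [hd]
  -- If the sum is below `R`, both points lie in the sublevel set, so the minorization applies to
  -- each of them.
  by_cases hs : R ≤ V x + V y
  · refine (le_self_add.trans hmain).trans ?_
    have := h1 (V x + V y) (by exact_mod_cast hs)
    exact_mod_cast this
  · have hx : V x ≤ R := le_self_add.trans (not_le.1 hs).le
    have hy : V y ≤ R := le_add_self.trans (not_le.1 hs).le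
    have h3 := h2 (V x + V y) (by positivity)
    have h4 : (2 : ℝ≥0∞) + β * (γ * (V x + V y) + 2 * b)
        ≤ ρ * (2 + β * (V x + V y)) + α * α * 2 := by exact_mod_cast h3
    have h5 : coupledDist K (weightedDist V β) x y + α * α * 2
        ≤ coupledDist K (weightedDist V β) x y + K x z * K y z * 2 := by
      gcongr <;> [exact hz x hx; exact hz y hy]
    exact (ENNReal.add_le_add_iff_right (by finiteness)).1 ((h5.trans hmain).trans h4)

/-! #### Convergence of the transition probabilities -/

/-- The possible return times of an irreducible aperiodic chain contain all large numbers. -/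
theorem exists_forall_ge_stepProb_pos {P : S → PMF S} (hI : Irreducible P) (hA : Aperiodic P)
    (x z : S) : ∃ N, ∀ m ≥ N, 0 < stepProb P m x z := by
  set T : Set ℕ := {k | 1 ≤ k ∧ 0 < stepProb P k z z} with hT
  have hgcd : Nat.setGcd T = 1 :=
    hA z _ fun k hk hpos => Nat.setGcd_dvd_of_mem ⟨hk, hpos⟩
  have hcl : ∀ k ∈ AddSubmonoid.closure T, 0 < stepProb P k z z := fun k hk => by
    refine AddSubmonoid.closure_induction (fun k hk => hk.2) ?_ (fun i j _ _ hi hj => ?_) hk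
    · classical simp [stepProb]
    · exact (ENNReal.mul_pos hi.ne' hj.ne').trans_le (mul_le_stepProb_add P i j z z z)
  -- A set of naturals generates, under addition, all large multiples of its gcd.
  obtain ⟨N, hN⟩ := Nat.exists_mem_closure_of_ge T
  obtain ⟨k, hk⟩ := hI x z
  refine ⟨k + N, fun m hm => ?_⟩
  have h1 := hcl (m - k) (hN _ (by omega) (by rw [hgcd]; exact one_dvd _))
  have h2 := mul_le_stepProb_add P k (m - k) x z z
  rw [show k + (m - k) = m by omega] at h2
  exact (ENNReal.mul_pos hk.ne' h1.ne').trans_le h2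

theorem exists_minorization {P : S → PMF S} (hI : Irreducible P) (hA : Aperiodic P) {C : Set S}
    (hC : C.Finite) (z : S) :
    ∃ m ≥ 1, ∃ α : ℝ≥0, 0 < α ∧ ∀ x ∈ C, (α : ℝ≥0∞) ≤ stepProb P m x z := by
  have h1 : ∃ m ≥ 1, ∀ x ∈ C, 0 < stepProb P m x z := by
    choose N hN using fun x => exists_forall_ge_stepProb_pos hI hA x z
    obtain ⟨B, hB⟩ := (hC.image N).bddAbove
    exact ⟨B + 1, by omega, fun x hx => hN x _ ((hB ⟨x, hx, rfl⟩).trans (by omega))⟩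
  obtain ⟨m, hm, hpos⟩ := h1
  refine ⟨m, hm, ?_⟩
  rcases C.eq_empty_or_nonempty with rfl | hne
  · exact ⟨1, one_pos, by simp⟩
  obtain ⟨x₀, hx₀, hmin⟩ := Set.exists_min_image C (fun x => stepProb P m x z) hC hne
  refine ⟨(stepProb P m x₀ z).toNNReal, ?_, fun x hx => ?_⟩
  · exact ENNReal.toNNReal_pos (hpos x₀ hx₀).ne' (ne_top_of_le_ne_top (by simp)
      (stepProb_le_one P m x₀ z))
  · exact ENNReal.coe_toNNReal_le_self.trans (hmin x hx)

/-- Each block of `m` steps improves the Lipschitz constant by `ρ`. Equal starting points are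
treated apart: independent copies separate, so no contraction is available there, but the difference
is zero. -/
theorem kernelAct_stepProb_mul_le_add {P : S → PMF S} {m : ℕ} {d : S → S → ℝ≥0∞} {ρ : ℝ≥0}
    (hd : ∀ x y, x ≠ y → coupledDist (stepProb P m) d x y ≤ ρ * d x y) {φ : S → ℝ≥0∞}
    (hφ : ∀ x y, φ x ≤ φ y + d x y) (k : ℕ) (x y : S) :
    kernelAct (stepProb P (m * k)) φ x
      ≤ kernelAct (stepProb P (m * k)) φ y + (ρ : ℝ≥0∞) ^ k * d x y := by
  induction k generalizing x y with
  | zero => simpa [kernelAct_stepProb_zero] using hφ x y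
  | succ k ih =>
    rcases eq_or_ne x y with rfl | hxy
    · exact le_self_add
    rw [show m * (k + 1) = m + m * k by ring, kernelAct_stepProb_add, kernelAct_stepProb_add]
    refine (kernelAct_le_add_of_le_add (tsum_stepProb P m) ih x y).trans ?_
    rw [pow_succ, mul_assoc]
    gcongr
    exact hd x y hxy

theorem exists_drift_fixed_point {γ : ℝ≥0} (hγ : γ < 1) (b : ℝ≥0) :
    ∃ L : ℝ≥0, γ * L + b = L ∧ (L : ℝ) = b / (1 - γ) := by
  have h : 0 < 1 - (γ : ℝ) := sub_pos.2 (by exact_mod_cast hγ)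
  refine ⟨⟨b / (1 - γ), by positivity⟩, ?_, rfl⟩
  apply NNReal.coe_injective
  change (γ : ℝ) * (b / (1 - γ)) + b = b / (1 - γ)
  field_simp
  ring

theorem abs_toReal_sub_le {a b e : ℝ≥0∞} (ha : a ≠ ∞) (hb : b ≠ ∞) (he : e ≠ ∞)
    (h1 : a ≤ b + e) (h2 : b ≤ a + e) : |a.toReal - b.toReal| ≤ e.toReal := by
  have h1' := ENNReal.toReal_mono (by finiteness) h1
  have h2' := ENNReal.toReal_mono (by finiteness) h2
  rw [ENNReal.toReal_add (by finiteness) he] at h1' h2'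
  rw [abs_le]; constructor <;> linarith

theorem stepProb_ne_top (P : S → PMF S) (k : ℕ) (x y : S) : stepProb P k x y ≠ ∞ :=
  ne_top_of_le_ne_top ENNReal.one_ne_top (stepProb_le_one P k x y)

/-- `L` is the limit law of the chain: the transition probabilities converge to it. -/
def IsLimitLaw (P : S → PMF S) (L : S → ℝ≥0∞) : Prop :=
  ∀ x y, Tendsto (fun t => stepProb P t x y) atTop (𝓝 (L y))

/-- Harris' theorem in its contraction form. The minorization is available because sublevel sets of
`V` are finite, and the contraction makes the transition probabilities Cauchy in time and forget the
starting point. -/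
theorem exists_isLimitLaw [Nonempty S] {P : S → PMF S} (hI : Irreducible P) (hA : Aperiodic P)
    {V : S → ℝ≥0} {γ b : ℝ≥0} (hγ : γ < 1) (hV : GeometricDrift P V γ b)
    (hfin : ∀ R, {x | V x ≤ R}.Finite) : ∃ L, IsLimitLaw P L := by
  obtain ⟨c, hc, -⟩ := exists_drift_fixed_point hγ b
  have hγ' : 0 < 1 - (γ : ℝ) := sub_pos.2 (by exact_mod_cast hγ)
  obtain ⟨R, hR⟩ : ∃ R : ℝ≥0, R * (1 - (γ : ℝ)) = 4 * c + 1 :=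
    ⟨⟨(4 * c + 1) / (1 - γ), by positivity⟩, div_mul_cancel₀ _ hγ'.ne'⟩
  obtain ⟨z⟩ := ‹Nonempty S›
  obtain ⟨m, hm, α, hα, hmin⟩ := exists_minorization hI hA (hfin R) z
  -- The contraction is for `m` steps, so the drift must be too: iteration keeps the factor `γ` and
  -- replaces `b` by the fixed point `c`. This is why `R` is computed from `c`.
  have hVm : ∀ x, kernelAct (stepProb P m) (fun y => (V y : ℝ≥0∞)) x ≤ γ * V x + c := fun x => by
    refine (hV.stepProb_le hc.le m x).trans ?_
    gcongr
    exact pow_le_of_le_one (by simp) (by exact_mod_cast hγ.le) (by omega)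
  obtain ⟨β, ρ, hρ, hcontr⟩ := exists_coupledDist_le (tsum_stepProb P m) hγ hα hR hVm hmin
  set d := weightedDist V β with hd
  have hdtop : ∀ x y, d x y ≠ ∞ := fun x y =>
    ne_top_of_le_ne_top (by finiteness) (weightedDist_le V β x y)
  -- the oscillation of the transition probabilities decays geometrically
  have hosc : ∀ t x x' y, stepProb P t x y ≤ stepProb P t x' y + (ρ : ℝ≥0∞) ^ (t / m) * d x x' := by
    classical
    intro t x x' y
    -- The `t % m` leftover steps go into the test function. It is bounded by `1`, hence Lipschitz
    -- for a distance that is at least `2` off the diagonal.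
    have key := kernelAct_stepProb_mul_le_add hcontr (φ := fun w => stepProb P (t % m) w y)
      (fun u w => by
        rw [hd, weightedDist]
        split_ifs with huw
        · simp [huw]
        · calc stepProb P (t % m) u y ≤ 1 := stepProb_le_one _ _ _ _
            _ ≤ 2 := by norm_num
            _ ≤ 2 + β * (V u + V w) := le_self_add
            _ ≤ _ := le_add_self) (t / m) x x'
    simpa only [kernelAct, ← stepProb_add, Nat.div_add_mod] using key
  -- The law at time `t + j` is an average, over the state at time `j`, of laws at time `t`. The
  -- oscillation bound averages well because the mean of `V` is bounded uniformly in `j`.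
  have hcauchy : ∀ t j x y, |(stepProb P t x y).toReal - (stepProb P (t + j) x y).toReal|
      ≤ (ρ : ℝ) ^ (t / m) * (2 + β * (V x + (V x + c))) := by
    intro t j x y
    have hj : kernelAct (stepProb P j) (fun u => (V u : ℝ≥0∞)) x ≤ V x + c := by
      refine (hV.stepProb_le hc.le j x).trans ?_
      gcongr
      exact mul_le_of_le_one_left (by simp) (pow_le_one' (by exact_mod_cast hγ.le) _)
    have hsum : kernelAct (stepProb P j) (fun u => (2 : ℝ≥0∞) + β * (V x + V u)) x
        ≤ 2 + β * (V x + (V x + c)) := by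
      rw [kernelAct_add, kernelAct_const_mul, kernelAct_add, kernelAct_const (tsum_stepProb P j),
        kernelAct_const (tsum_stepProb P j)]
      gcongr
    have hadd : stepProb P (t + j) x y
        = kernelAct (stepProb P j) (fun u => stepProb P t u y) x := by
      rw [add_comm, stepProb_add]; rfl
    have hle : ∀ u, (ρ : ℝ≥0∞) ^ (t / m) * d u x ≤ (ρ : ℝ≥0∞) ^ (t / m) * (2 + β * (V x + V u)) :=
      fun u => by
        gcongr
        exact (weightedDist_le V β u x).trans (by rw [add_comm (V u : ℝ≥0∞)])
    have hle' : ∀ u, (ρ : ℝ≥0∞) ^ (t / m) * d x u ≤ (ρ : ℝ≥0∞) ^ (t / m) * (2 + β * (V x + V u)) :=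
      fun u => by gcongr; exact weightedDist_le V β x u
    have h1 : stepProb P (t + j) x y
        ≤ stepProb P t x y + (ρ : ℝ≥0∞) ^ (t / m) * (2 + β * (V x + (V x + c))) := by
      rw [hadd]
      refine (kernelAct_mono _ (fun u => (hosc t u x y).trans (by grw [hle u])) x).trans ?_
      rw [kernelAct_add, kernelAct_const_mul, kernelAct_const (tsum_stepProb P j)]
      gcongr
    have h2 : stepProb P t x y
        ≤ stepProb P (t + j) x y + (ρ : ℝ≥0∞) ^ (t / m) * (2 + β * (V x + (V x + c))) := by
      rw [hadd]
      conv_lhs => rw [← kernelAct_const (tsum_stepProb P j) (stepProb P t x y) x]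
      refine (kernelAct_mono _ (fun u => (hosc t x u y).trans (by grw [hle' u])) x).trans ?_
      rw [kernelAct_add, kernelAct_const_mul]
      gcongr
    have h3 := abs_toReal_sub_le (stepProb_ne_top P t x y) (stepProb_ne_top P (t + j) x y)
      (by finiteness) h2 h1
    refine h3.trans (le_of_eq ?_)
    norm_cast
  have hpow : ∀ C : ℝ, Tendsto (fun t => (ρ : ℝ) ^ (t / m) * C) atTop (𝓝 0) := fun C => by
    have := ((tendsto_pow_atTop_nhds_zero_of_lt_one ρ.2 (by exact_mod_cast hρ)).comp
      (Nat.tendsto_div_const_atTop (n := m) (by omega))).mul_const C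
    simpa using this
  have hlim : ∀ y, ∃ l : ℝ, Tendsto (fun t => (stepProb P t z y).toReal) atTop (𝓝 l) := fun y =>
    cauchySeq_tendsto_of_complete <| cauchySeq_of_le_tendsto_0' _ (fun t t' htt' => by
      obtain ⟨j, rfl⟩ := Nat.exists_eq_add_of_le htt'
      rw [Real.dist_eq]
      exact hcauchy t j z y) (hpow _)
  choose l hl using hlim
  refine ⟨fun y => ENNReal.ofReal (l y), fun x y => ?_⟩
  have hx : Tendsto (fun t => (stepProb P t x y).toReal) atTop (𝓝 (l y)) := by
    have h0 : Tendsto (fun t => (stepProb P t x y).toReal - (stepProb P t z y).toReal)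
        atTop (𝓝 0) := by
      refine squeeze_zero_norm (fun t => ?_) (hpow (2 + β * (V x + V z)))
      rw [Real.norm_eq_abs]
      have h3 := abs_toReal_sub_le (stepProb_ne_top P t x y) (stepProb_ne_top P t z y)
        (e := (ρ : ℝ≥0∞) ^ (t / m) * (2 + β * (V x + V z))) (by finiteness)
        ((hosc t x z y).trans (by gcongr; exact weightedDist_le V β x z))
        ((hosc t z x y).trans (by
          gcongr; exact (weightedDist_le V β z x).trans (by rw [add_comm (V x : ℝ≥0∞)])))
      refine h3.trans (le_of_eq ?_)
      norm_cast
    simpa using h0.add (hl y)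
  have := (ENNReal.continuous_ofReal.tendsto _).comp hx
  refine this.congr fun t => ?_
  simp [ENNReal.ofReal_toReal (stepProb_ne_top P t x y)]

namespace IsLimitLaw

variable {P : S → PMF S} {L : S → ℝ≥0∞}

theorem tendsto_sum (hL : IsLimitLaw P L) {f : S → ℝ≥0∞} (hf : ∀ y, f y ≠ ∞) (F : Finset S)
    (x : S) :
    Tendsto (fun t => ∑ y ∈ F, stepProb P t x y * f y) atTop (𝓝 (∑ y ∈ F, L y * f y)) :=
  tendsto_finsetSum _ fun y _ => ENNReal.Tendsto.mul_const (hL x y) (Or.inr (hf y))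

/-- Fatou: finite partial sums pass to the limit under a bound that converges. -/
theorem tsum_mul_le (hL : IsLimitLaw P L) {f : S → ℝ≥0∞} (hf : ∀ y, f y ≠ ∞) {x : S}
    {B : ℕ → ℝ≥0∞} {c : ℝ≥0∞} (hB : ∀ t, kernelAct (stepProb P t) f x ≤ B t)
    (hc : Tendsto B atTop (𝓝 c)) : ∑' y, L y * f y ≤ c := by
  rw [ENNReal.tsum_eq_iSup_sum]
  refine iSup_le fun F => ?_
  exact le_of_tendsto_of_tendsto' (hL.tendsto_sum hf F x) hc fun t =>
    (ENNReal.sum_le_tsum F).trans (hB t)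

/-- A geometric drift inequality bounds the mean under the limit law. -/
theorem tsum_mul_le_of_drift [Nonempty S] (hL : IsLimitLaw P L) {f : S → ℝ≥0} {γ b c : ℝ≥0}
    (hγ : γ < 1) (hf : GeometricDrift P f γ b) (hc : γ * c + b = c) :
    ∑' y, L y * f y ≤ c := by
  obtain ⟨x⟩ := ‹Nonempty S›
  refine hL.tsum_mul_le (f := fun y => (f y : ℝ≥0∞)) (by simp) (hf.stepProb_le hc.le · x) ?_
  have h1 : Tendsto (fun t => (γ : ℝ≥0∞) ^ t * f x) atTop (𝓝 (0 * f x)) :=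
    ENNReal.Tendsto.mul_const
      (ENNReal.tendsto_pow_atTop_nhds_zero_of_lt_one (by exact_mod_cast hγ)) (Or.inr (by simp))
  simpa using h1.add_const (c : ℝ≥0∞)

/-- No mass escapes: by the drift the mean of `V` is bounded in time, so Markov's inequality
confines the law to a finite sublevel set up to small mass. -/
theorem tsum_eq_one [Nonempty S] (hL : IsLimitLaw P L) {V : S → ℝ≥0} {γ b : ℝ≥0} (hγ : γ < 1)
    (hV : GeometricDrift P V γ b) (hfin : ∀ R, {x | V x ≤ R}.Finite) : ∑' y, L y = 1 := by
  obtain ⟨c, hc, -⟩ := exists_drift_fixed_point hγ b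
  obtain ⟨x⟩ := ‹Nonempty S›
  apply le_antisymm
  · simpa using hL.tsum_mul_le (f := fun _ => 1) (by simp) (x := x) (B := fun _ => 1)
      (fun t => (kernelAct_const (tsum_stepProb P t) 1 x).le) tendsto_const_nhds
  -- the mass outside a sublevel set of `V` is small, uniformly in time
  have hR : ∀ R : ℝ≥0, 0 < R → 1 ≤ ∑' y, L y + (V x + c : ℝ≥0) / R := fun R hR => by
    have hR' : (R : ℝ≥0∞) ≠ 0 := by exact_mod_cast hR.ne'
    have h1 : ∀ t, 1 ≤ ∑ y ∈ (hfin R).toFinset, stepProb P t x y * 1 + (V x + c : ℝ≥0) / R := by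
      classical
      intro t
      have h2 : ∀ y, (1 : ℝ≥0∞)
          ≤ (if y ∈ (hfin R).toFinset then 1 else 0) + (R : ℝ≥0∞)⁻¹ * V y := by
        intro y
        split_ifs with hy
        · exact le_self_add
        · have hy' : (R : ℝ≥0∞) ≤ V y := by
            simp only [Set.Finite.mem_toFinset, Set.mem_ofPred_eq, not_le] at hy
            exact_mod_cast hy.le
          rw [zero_add, ← ENNReal.inv_mul_cancel hR' (by simp)]
          gcongr
      have h3 := kernelAct_mono (stepProb P t) h2 x
      rw [kernelAct_const (tsum_stepProb P t), kernelAct_add, kernelAct_const_mul] at h3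
      have h4 : kernelAct (stepProb P t) (fun y => (V y : ℝ≥0∞)) x ≤ (V x + c : ℝ≥0) := by
        refine (hV.stepProb_le hc.le t x).trans ?_
        push_cast
        gcongr
        exact mul_le_of_le_one_left (by simp) (pow_le_one' (by exact_mod_cast hγ.le) _)
      have h5 : kernelAct (stepProb P t) (fun y => if y ∈ (hfin R).toFinset then 1 else 0) x
          = ∑ y ∈ (hfin R).toFinset, stepProb P t x y * 1 := by
        unfold kernelAct
        rw [tsum_eq_sum (s := (hfin R).toFinset) (fun y hy => by simp [hy])]
        exact Finset.sum_congr rfl fun y hy => by simp only [hy, if_true]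
      rw [h5] at h3
      refine h3.trans ?_
      rw [ENNReal.div_eq_inv_mul]
      gcongr
    have h6 := ge_of_tendsto' ((hL.tendsto_sum (f := fun _ => 1) (by simp)
      (hfin R).toFinset x).add_const ((V x + c : ℝ≥0) / R : ℝ≥0∞)) h1
    refine h6.trans ?_
    gcongr
    simpa using ENNReal.sum_le_tsum (f := L) (hfin R).toFinset
  have hlim : Tendsto (fun k : ℕ => ∑' y, L y + ((V x + c : ℝ≥0) : ℝ≥0∞) / ((k + 1 : ℕ) : ℝ≥0∞))
      atTop (𝓝 (∑' y, L y + 0)) := by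
    refine Tendsto.const_add _ ?_
    have h7 := ENNReal.Tendsto.const_div (a := ((V x + c : ℝ≥0) : ℝ≥0∞))
      ENNReal.tendsto_nat_nhds_top (Or.inr (by simp))
    rw [ENNReal.div_top] at h7
    exact h7.comp (tendsto_add_atTop_nat 1)
  rw [add_zero] at hlim
  exact ge_of_tendsto' hlim fun k => by
    simpa using hR ((k + 1 : ℕ) : ℝ≥0) (by positivity)

/-- Fatou gives only `≤`. Both sides have total mass one, so no inequality can be strict. -/
theorem stationary [Nonempty S] (hL : IsLimitLaw P L) (h1 : ∑' y, L y = 1) (y : S) :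
    ∑' x, L x * P x y = L y := by
  have hle : ∀ y, ∑' x, L x * P x y ≤ L y := fun y => by
    obtain ⟨x⟩ := ‹Nonempty S›
    refine hL.tsum_mul_le (x := x) (fun z => (P z).apply_ne_top y)
      (B := fun t => stepProb P (t + 1) x y) (fun t => ?_) ((hL x y).comp (tendsto_add_atTop_nat 1))
    rw [stepProb_add]
    simp only [stepProb_one]
    exact le_rfl
  have hsum : ∑' y, ∑' x, L x * P x y = 1 := by
    rw [ENNReal.tsum_comm]
    simp only [ENNReal.tsum_mul_left, (P _).tsum_coe, mul_one, h1]
  by_contra hne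
  have := ENNReal.tsum_lt_tsum (by rw [hsum]; simp) hle (lt_of_le_of_ne (hle y) hne)
  rw [hsum, h1] at this
  exact lt_irrefl _ this

theorem tsum_mul_kernelAct [Nonempty S] (hL : IsLimitLaw P L) (h1 : ∑' y, L y = 1)
    (f : S → ℝ≥0∞) :
    ∑' x, L x * kernelAct (fun a b => P a b) f x = ∑' y, L y * f y := by
  simp only [kernelAct, ← ENNReal.tsum_mul_left]
  rw [ENNReal.tsum_comm]
  refine tsum_congr fun y => ?_
  rw [← hL.stationary h1 y, ← ENNReal.tsum_mul_right]
  exact tsum_congr fun x => by ring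

theorem pos [Nonempty S] (hL : IsLimitLaw P L) (h1 : ∑' y, L y = 1) (hI : Irreducible P) (y : S) :
    0 < L y := by
  obtain ⟨z, hz⟩ : ∃ z, L z ≠ 0 := by
    by_contra! h
    simp [h] at h1
  obtain ⟨k, hk⟩ := hI z y
  have h2 : L z * stepProb P k z y ≤ L y :=
    le_of_tendsto_of_tendsto'
      (ENNReal.Tendsto.mul_const (hL z z) (Or.inr (stepProb_ne_top P k z y)))
      ((hL z y).comp (tendsto_add_atTop_nat k)) fun t => mul_le_stepProb_add P t k z y z
  exact (ENNReal.mul_pos hz hk.ne').trans_le h2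

end IsLimitLaw

/-! #### Positive recurrence -/

open Classical in
/-- The probability that the chain started at `y` is not at `x` at the times `1, …, k`. -/
noncomputable def avoidProb (P : S → PMF S) (x : S) : ℕ → S → ℝ≥0∞
  | 0, _ => 1
  | k + 1, y => ∑' z, P y z * if z = x then 0 else avoidProb P x k z

theorem avoidProb_le_one (P : S → PMF S) (x : S) (k : ℕ) (y : S) : avoidProb P x k y ≤ 1 := by
  induction k generalizing y with
  | zero => simp [avoidProb]
  | succ k ih =>
    rw [avoidProb, ← (P y).tsum_coe]
    refine ENNReal.tsum_le_tsum fun z => ?_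
    split_ifs
    · simp
    · exact mul_le_of_le_one_right (by simp) (ih z)

theorem firstPassage_add_avoidProb (P : S → PMF S) (x : S) (k : ℕ) (y : S) :
    firstPassage P x (k + 1) y + avoidProb P x (k + 1) y = avoidProb P x k y := by
  classical
  induction k generalizing y with
  | zero =>
    simp only [firstPassage, avoidProb]
    rw [← kernelAct_ite (fun a b => P a b) y x, kernelAct, ← ENNReal.tsum_add, ← (P y).tsum_coe]
    refine tsum_congr fun z => ?_
    split_ifs <;> simp
  | succ k ih =>
    rw [firstPassage, avoidProb, avoidProb, ← ENNReal.tsum_add]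
    refine tsum_congr fun z => ?_
    split_ifs with h
    · simp
    · rw [← mul_add, ih]

/-- Last-visit decomposition: the events that the last visit to `x` up to time `t` is at time `j`
are disjoint. -/
theorem sum_stepProb_mul_avoidProb_le (P : S → PMF S) (x : S) (t : ℕ) :
    ∑ j ∈ Finset.range (t + 1), stepProb P j x x * avoidProb P x (t - j) x ≤ 1 := by
  classical
  -- The induction needs any starting point `y`; the extra term is the event of no visit at any of
  -- the times `0, …, t`.
  suffices h : ∀ y, ∑ j ∈ Finset.range (t + 1), stepProb P j y x * avoidProb P x (t - j) x
      + (if y = x then 0 else avoidProb P x t y) ≤ 1 from le_self_add.trans (h x)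
  induction t with
  | zero =>
    intro y
    by_cases h : y = x <;> simp [stepProb, avoidProb, h]
  | succ t ih =>
    intro y
    have h1 : ∑ j ∈ Finset.range (t + 1 + 1), stepProb P j y x * avoidProb P x (t + 1 - j) x
        + (if y = x then 0 else avoidProb P x (t + 1) y)
        = kernelAct (fun a b => P a b) (fun z =>
          ∑ j ∈ Finset.range (t + 1), stepProb P j z x * avoidProb P x (t - j) x
            + if z = x then 0 else avoidProb P x t z) y := by
      rw [kernelAct_add, Finset.sum_range_succ', add_assoc]
      congr 1
      · simp only [kernelAct, Finset.mul_sum]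
        rw [Summable.tsum_finsetSum fun _ _ => ENNReal.summable]
        refine Finset.sum_congr rfl fun j _ => ?_
        rw [stepProb, ← ENNReal.tsum_mul_right, Nat.add_sub_add_right]
        exact tsum_congr fun z => by ring
      · change _ = avoidProb P x (t + 1) y
        by_cases h : y = x <;> simp [stepProb, h]
    rw [h1]
    refine (kernelAct_mono _ ih y).trans ?_
    rw [kernelAct_const fun x => (P x).tsum_coe]

theorem sum_firstPassage_add_avoidProb (P : S → PMF S) (x y : S) (k : ℕ) :
    ∑ j ∈ Finset.range (k + 1), firstPassage P x j y + avoidProb P x k y = 1 := by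
  induction k with
  | zero => simp [firstPassage, avoidProb]
  | succ k ih =>
    rw [Finset.sum_range_succ, add_assoc, firstPassage_add_avoidProb, ih]

theorem sum_mul_firstPassage_add (P : S → PMF S) (x y : S) (k : ℕ) :
    ∑ j ∈ Finset.range (k + 1), (j : ℝ≥0∞) * firstPassage P x j y + k * avoidProb P x k y
      = ∑ j ∈ Finset.range k, avoidProb P x j y := by
  induction k with
  | zero => simp
  | succ k ih =>
    rw [Finset.sum_range_succ, Finset.sum_range_succ (avoidProb P x · y), ← ih, add_assoc,
      ← mul_add, firstPassage_add_avoidProb]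
    push_cast
    ring

/-- As `t → ∞`, the last-visit decomposition bounds `L x` times the sum of the avoidance
probabilities by `1`. That sum is the mean return time; its finiteness also forces the avoidance
probabilities to zero, so return is certain. -/
theorem IsLimitLaw.positiveRecurrent [Nonempty S] {P : S → PMF S} {L : S → ℝ≥0∞}
    (hL : IsLimitLaw P L) (hpos : ∀ y, 0 < L y) : PositiveRecurrent P := by
  intro x
  have hG : ∑' j, avoidProb P x j x ≤ (L x)⁻¹ := by
    rw [ENNReal.tsum_eq_iSup_nat]
    refine iSup_le fun N => ?_
    have h1 : ∀ t, ∑ j ∈ Finset.range N, stepProb P (t + (N - j)) x x * avoidProb P x j x ≤ 1 := by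
      intro t
      refine le_trans ?_ (sum_stepProb_mul_avoidProb_le P x (t + N))
      conv_rhs => rw [← Finset.sum_range_reflect]
      refine le_trans (Finset.sum_le_sum fun j hj => ?_)
        (Finset.sum_le_sum_of_subset (Finset.range_subset_range.2 (by omega : N ≤ t + N + 1)))
      have hj' : j < N := Finset.mem_range.1 hj
      rw [show t + N + 1 - 1 - j = t + (N - j) by omega, show t + N - (t + (N - j)) = j by omega]
    have h2 : Tendsto
        (fun t => ∑ j ∈ Finset.range N, stepProb P (t + (N - j)) x x * avoidProb P x j x)
        atTop (𝓝 (∑ j ∈ Finset.range N, L x * avoidProb P x j x)) :=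
      tendsto_finsetSum _ fun j _ => ENNReal.Tendsto.mul_const
        ((hL x x).comp (tendsto_add_atTop_nat (N - j)))
        (Or.inr (ne_top_of_le_ne_top ENNReal.one_ne_top (avoidProb_le_one P x j x)))
    have h3 := le_of_tendsto' h2 h1
    rw [← Finset.mul_sum, mul_comm] at h3
    exact ENNReal.le_inv_iff_mul_le.2 h3
  have hGtop : ∑' j, avoidProb P x j x ≠ ∞ :=
    ne_top_of_le_ne_top (ENNReal.inv_ne_top.2 (hpos x).ne') hG
  constructor
  · have h1 := ((ENNReal.tendsto_nat_tsum (firstPassage P x · x)).comp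
      (tendsto_add_atTop_nat 1)).add (ENNReal.tendsto_atTop_zero_of_tsum_ne_top hGtop)
    rw [add_zero] at h1
    refine tendsto_nhds_unique h1 (tendsto_const_nhds.congr fun k => ?_)
    exact (sum_firstPassage_add_avoidProb P x x k).symm
  · refine lt_of_le_of_lt ?_ hGtop.lt_top
    rw [ENNReal.tsum_eq_iSup_nat]
    refine iSup_le fun k => ?_
    calc _ ≤ ∑ j ∈ Finset.range (k + 1), (j : ℝ≥0∞) * firstPassage P x j x :=
          Finset.sum_le_sum_of_subset (Finset.range_subset_range.2 (by omega))
      _ ≤ _ := le_self_add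
      _ = _ := sum_mul_firstPassage_add P x x k
      _ ≤ _ := ENNReal.sum_le_tsum _

end MarkovChains

/-! ### Convex geometry of the cone and of doubly stochastic matrices. -/

section Geometry

variable {n : ℕ}

theorem inner_eq_sum (x y : RealMatrix n) : inner ℝ x y = ∑ i, ∑ j, x (i, j) * y (i, j) := by
  rw [PiLp.inner_apply, Fintype.sum_prod_type]
  simp [mul_comm]

theorem norm_sq_eq_sum (x : RealMatrix n) : ‖x‖ ^ 2 = ∑ i, ∑ j, x (i, j) ^ 2 := by
  rw [← real_inner_self_eq_norm_sq, inner_eq_sum]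
  simp only [sq]

/-! #### The projection onto the cone -/

theorem add_smul_mem_cone {x y : RealMatrix n} (hx : x ∈ cone n) (hy : y ∈ cone n) {t : ℝ}
    (ht : 0 ≤ t) : x + t • y ∈ cone n :=
  ⟨Submodule.add_mem _ hx.1 (Submodule.smul_mem _ _ hy.1), fun p => by
    simpa using add_nonneg (hx.2 p) (mul_nonneg ht (hy.2 p))⟩

theorem projCone_mem (x : RealMatrix n) : projCone x ∈ cone n := (exists_nearest x).choose_spec.1

theorem norm_perpCone_le (x : RealMatrix n) {y : RealMatrix n} (hy : y ∈ cone n) :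
    ‖perpCone x‖ ≤ ‖x - y‖ :=
  (exists_nearest x).choose_spec.2 y hy

theorem projCone_add_perpCone (x : RealMatrix n) : projCone x + perpCone x = x := by
  simp [perpCone]

/-- First-order optimality of the nearest point: a feasible direction cannot decrease the distance.
-/
theorem inner_perpCone_nonpos_of_segment {x z : RealMatrix n}
    (h : ∀ t ∈ Set.Icc (0 : ℝ) 1, projCone x + t • z ∈ cone n) : inner ℝ (perpCone x) z ≤ 0 := by
  by_contra! hpos
  have hle : ∀ t ∈ Set.Icc (0 : ℝ) 1, 2 * t * inner ℝ (perpCone x) z ≤ t ^ 2 * ‖z‖ ^ 2 := by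
    intro t ht
    have h1 := norm_perpCone_le x (h t ht)
    rw [← sub_sub, show x - projCone x = perpCone x from rfl] at h1
    have h2 := pow_le_pow_left₀ (norm_nonneg _) h1 2
    rw [norm_sub_sq_real, inner_smul_right, norm_smul, Real.norm_of_nonneg ht.1, mul_pow] at h2
    linarith
  set w : ℝ := inner ℝ (perpCone x) z with hw
  have hz : 0 < ‖z‖ ^ 2 + w := by positivity
  -- This step length lies in `(0, 1]` and is short enough for the linear gain to beat the quadratic
  -- loss.
  have h1 := hle (w / (‖z‖ ^ 2 + w))
    ⟨by positivity, (div_le_one hz).2 (by nlinarith [sq_nonneg ‖z‖])⟩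
  have h2 : w / (‖z‖ ^ 2 + w) * (‖z‖ ^ 2 + w) = w := div_mul_cancel₀ _ hz.ne'
  set r := w / (‖z‖ ^ 2 + w)
  have hr : 0 < r := by positivity
  have h3 : 2 * w ≤ r * ‖z‖ ^ 2 := by
    have : r * (2 * w) ≤ r * (r * ‖z‖ ^ 2) := by nlinarith
    exact le_of_mul_le_mul_left this hr
  nlinarith

theorem inner_perpCone_nonpos (x : RealMatrix n) {y : RealMatrix n} (hy : y ∈ cone n) :
    inner ℝ (perpCone x) y ≤ 0 :=
  inner_perpCone_nonpos_of_segment fun _ ht => add_smul_mem_cone (projCone_mem x) hy ht.1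

/-- A cone contains the segment from a point to the origin, so `-projCone x` is also a feasible
direction. -/
theorem inner_perpCone_projCone (x : RealMatrix n) : inner ℝ (perpCone x) (projCone x) = 0 := by
  refine le_antisymm (inner_perpCone_nonpos x (projCone_mem x)) ?_
  have h := inner_perpCone_nonpos_of_segment (x := x) (z := -projCone x) fun t ht => by
    have := add_smul_mem_cone (zero_mem_cone n) (projCone_mem x) (sub_nonneg.2 ht.2)
    convert this using 1
    module
  rw [inner_neg_right] at h
  linarith

theorem norm_sq_eq_projCone_add_perpCone (x : RealMatrix n) :
    ‖x‖ ^ 2 = ‖projCone x‖ ^ 2 + ‖perpCone x‖ ^ 2 := by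
  conv_lhs => rw [← projCone_add_perpCone x]
  rw [norm_add_sq_real, real_inner_comm, inner_perpCone_projCone]
  ring

theorem inner_perpCone_self (x : RealMatrix n) : inner ℝ x (perpCone x) = ‖perpCone x‖ ^ 2 := by
  calc inner ℝ x (perpCone x) = inner ℝ (projCone x + perpCone x) (perpCone x) := by
        rw [projCone_add_perpCone]
    _ = _ := by
        rw [inner_add_left, real_inner_comm, inner_perpCone_projCone, real_inner_self_eq_norm_sq,
          zero_add]

theorem abs_norm_perpCone_sub_le (x y : RealMatrix n) :
    |‖perpCone x‖ - ‖perpCone y‖| ≤ ‖x - y‖ := by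
  have h : ∀ x y : RealMatrix n, ‖perpCone x‖ - ‖perpCone y‖ ≤ ‖x - y‖ := fun x y => by
    have h1 := norm_perpCone_le x (projCone_mem y)
    have h2 : x - projCone y = (x - y) + perpCone y := by simp [perpCone]
    rw [h2] at h1
    linarith [norm_add_le (x - y) (perpCone y)]
  rw [abs_le]
  have := h y x
  rw [norm_sub_rev] at this
  exact ⟨by linarith, h x y⟩

/-- The subgradient inequality for the convex function `‖projCone x‖²`, whose gradient is `2
projCone x`; it follows from polarity of `perpCone y`. -/
theorem two_mul_inner_projCone_le (x y : RealMatrix n) :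
    2 * inner ℝ (projCone x) (y - x) ≤ ‖projCone y‖ ^ 2 - ‖projCone x‖ ^ 2 := by
  have h1 : inner ℝ (projCone x) (y - x)
      = inner ℝ (projCone x) (projCone y) - ‖projCone x‖ ^ 2
        + inner ℝ (perpCone y) (projCone x) := by
    have hx : inner ℝ (projCone x) x = ‖projCone x‖ ^ 2 := by
      calc inner ℝ (projCone x) x = inner ℝ (projCone x) (projCone x + perpCone x) := by
            rw [projCone_add_perpCone]
        _ = _ := by
            rw [inner_add_right, real_inner_comm (perpCone x), inner_perpCone_projCone,
              real_inner_self_eq_norm_sq, add_zero]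
    rw [inner_sub_right, hx, real_inner_comm (projCone x) (perpCone y)]
    conv_lhs => rw [← projCone_add_perpCone y]
    rw [inner_add_right]
    ring
  have h2 := inner_perpCone_nonpos y (projCone_mem x)
  have h3 := norm_sub_sq_real (projCone x) (projCone y)
  nlinarith [sq_nonneg ‖projCone x - projCone y‖]

theorem rowOnes_mem_cone (i : Fin n) : rowOnes i ∈ cone n :=
  ⟨Submodule.subset_span (Or.inl ⟨i, rfl⟩), fun p => by simp only [rowOnes]; split_ifs <;> simp⟩

theorem colOnes_mem_cone (j : Fin n) : colOnes j ∈ cone n :=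
  ⟨Submodule.subset_span (Or.inr ⟨j, rfl⟩), fun p => by simp only [colOnes]; split_ifs <;> simp⟩

theorem inner_rowOnes (x : RealMatrix n) (i : Fin n) : inner ℝ x (rowOnes i) = ∑ j, x (i, j) := by
  rw [inner_eq_sum]
  simp [rowOnes]

theorem inner_colOnes (x : RealMatrix n) (j : Fin n) : inner ℝ x (colOnes j) = ∑ i, x (i, j) := by
  rw [inner_eq_sum]
  simp [colOnes]

/-- A matrix with vanishing row and column sums is orthogonal to the collapse space. -/
theorem mem_collapseSpace_orthogonal {x : RealMatrix n} (hrow : ∀ i, ∑ j, x (i, j) = 0)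
    (hcol : ∀ j, ∑ i, x (i, j) = 0) : x ∈ (collapseSpace n)ᗮ := by
  rw [collapseSpace, Submodule.mem_orthogonal']
  intro y hy
  induction hy using Submodule.span_induction with
  | mem y hy =>
    rcases hy with ⟨i, rfl⟩ | ⟨j, rfl⟩
    · rw [inner_rowOnes, hrow]
    · rw [inner_colOnes, hcol]
  | zero => simp
  | add y z _ _ hy hz => rw [inner_add_right, hy, hz, add_zero]
  | smul c y _ hy => rw [inner_smul_right, hy, mul_zero]

/-! #### Schedules and doubly stochastic matrices -/

/-- A real matrix, seen in `ℝ^{n × n}`. -/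
noncomputable def ofMatrix (A : Matrix (Fin n) (Fin n) ℝ) : RealMatrix n :=
  WithLp.toLp 2 fun p => A p.1 p.2

@[simp]
theorem ofMatrix_apply (A : Matrix (Fin n) (Fin n) ℝ) (i j : Fin n) :
    ofMatrix A (i, j) = A i j := rfl

@[simp]
theorem toReal_apply (q : PacketMatrix n) (p : Fin n × Fin n) : toReal q p = (q p.1 p.2 : ℝ) := rfl

theorem weight_eq_inner (q s : PacketMatrix n) :
    (weight q s : ℝ) = inner ℝ (toReal q) (toReal s) := by
  simp [weight, inner_eq_sum]

theorem sum_row_of_mem_schedules {s : PacketMatrix n} (hs : s ∈ schedules n) (i : Fin n) :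
    ∑ j, (s i j : ℝ) = 1 := by
  obtain ⟨σ, rfl⟩ := hs
  simp [scheduleOf]

theorem sum_col_of_mem_schedules {s : PacketMatrix n} (hs : s ∈ schedules n) (j : Fin n) :
    ∑ i, (s i j : ℝ) = 1 := by
  obtain ⟨σ, rfl⟩ := hs
  simp only [scheduleOf, ← Equiv.eq_symm_apply]
  simp

theorem le_one_of_mem_schedules {s : PacketMatrix n} (hs : s ∈ schedules n) (i j : Fin n) :
    s i j ≤ 1 := by
  obtain ⟨σ, rfl⟩ := hs
  simp only [scheduleOf]
  split_ifs <;> simp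

/-- Birkhoff's theorem: a doubly stochastic matrix is a convex combination of schedules. -/
theorem inner_le_maxWeight (q : PacketMatrix n) {A : Matrix (Fin n) (Fin n) ℝ}
    (hA : A ∈ doublyStochastic ℝ (Fin n)) : inner ℝ (toReal q) (ofMatrix A) ≤ maxWeight q := by
  obtain ⟨w, hw0, hw1, rfl⟩ := exists_eq_sum_perm_of_mem_doublyStochastic hA
  have h1 : ofMatrix (∑ σ, w σ • σ.permMatrix ℝ) = ∑ σ, w σ • toReal (scheduleOf σ) := by
    ext ⟨i, j⟩
    simp [Matrix.sum_apply, scheduleOf, Equiv.Perm.permMatrix, PEquiv.toMatrix_apply, eq_comm]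
  rw [h1, inner_sum]
  calc _ = ∑ σ, w σ * (weight q (scheduleOf σ) : ℝ) := by
        simp only [inner_smul_right, weight_eq_inner]
    _ ≤ ∑ σ, w σ * (maxWeight q : ℝ) := by
        refine Finset.sum_le_sum fun σ _ => mul_le_mul_of_nonneg_left ?_ (hw0 σ)
        exact_mod_cast Finset.le_sup (f := fun σ => weight q (scheduleOf σ)) (Finset.mem_univ σ)
    _ = _ := by rw [← Finset.sum_mul, hw1, one_mul]

/-- A doubly substochastic matrix is dominated by a doubly stochastic one. -/
theorem exists_doublyStochastic_ge {A : Matrix (Fin n) (Fin n) ℝ} (h0 : ∀ i j, 0 ≤ A i j)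
    (hrow : ∀ i, ∑ j, A i j ≤ 1) (hcol : ∀ j, ∑ i, A i j ≤ 1) :
    ∃ B ∈ doublyStochastic ℝ (Fin n), ∀ i j, A i j ≤ B i j := by
  set r : Fin n → ℝ := fun i => 1 - ∑ j, A i j with hr
  set c : Fin n → ℝ := fun j => 1 - ∑ i, A i j with hc
  have hr0 : ∀ i, 0 ≤ r i := fun i => sub_nonneg.2 (hrow i)
  have hc0 : ∀ j, 0 ≤ c j := fun j => sub_nonneg.2 (hcol j)
  have hT : ∑ i, r i = ∑ j, c j := by
    simp only [hr, hc, Finset.sum_sub_distrib]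
    rw [Finset.sum_comm]
  rcases (Finset.sum_nonneg fun i _ => hr0 i : 0 ≤ ∑ i, r i).eq_or_lt' with h | h
  · have hr' : ∀ i, r i = 0 := fun i =>
      (Finset.sum_eq_zero_iff_of_nonneg fun i _ => hr0 i).1 h i (Finset.mem_univ i)
    have hc' : ∀ j, c j = 0 := fun j =>
      (Finset.sum_eq_zero_iff_of_nonneg fun i _ => hc0 i).1 (hT ▸ h) j (Finset.mem_univ j)
    exact ⟨A, mem_doublyStochastic_iff_sum.2 ⟨h0,
      fun i => by linarith [hr' i, show r i = 1 - ∑ j, A i j from rfl],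
      fun j => by linarith [hc' j, show c j = 1 - ∑ i, A i j from rfl]⟩, fun _ _ => le_rfl⟩
  -- The row and column deficits have the same total, so the rank-one matrix `r cᵀ` divided by this
  -- total fills both.
  · refine ⟨fun i j => A i j + r i * c j / ∑ i, r i, mem_doublyStochastic_iff_sum.2
      ⟨fun i j => ?_, fun i => ?_, fun j => ?_⟩, fun i j => ?_⟩
    · have := h0 i j; have := hr0 i; have := hc0 j; positivity
    · rw [Finset.sum_add_distrib, ← Finset.sum_div, ← Finset.mul_sum, ← hT,
        mul_div_cancel_right₀ _ h.ne']
      simp [hr]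
    · rw [Finset.sum_add_distrib, ← Finset.sum_div, ← Finset.sum_mul, mul_comm,
        mul_div_cancel_right₀ _ h.ne']
      simp [hc]
    · have := hr0 i; have := hc0 j
      have : 0 ≤ r i * c j / ∑ i, r i := by positivity
      linarith

/-- The weight of `ν` falls short of the largest weight by a multiple of the distance to the
cone. -/
theorem inner_add_mul_norm_perpCone_le_maxWeight (q : PacketMatrix n)
    {ν : Matrix (Fin n) (Fin n) ℝ} (hν : ν ∈ doublyStochastic ℝ (Fin n)) {δ : ℝ} (hδ : 0 ≤ δ)
    (hδν : ∀ i j, δ ≤ ν i j) :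
    inner ℝ (toReal q) (ofMatrix ν) + δ * ‖perpCone (toReal q)‖ ≤ maxWeight q := by
  set z := perpCone (toReal q) with hz
  rcases (norm_nonneg z).eq_or_lt' with h | h
  · rw [h, mul_zero, add_zero]
    exact inner_le_maxWeight q hν
  -- The perturbation has norm `δ`, so the entries stay nonnegative. Polarity against row and column
  -- matrices gives sums at most `1`, not equal to `1`, which is why a dominating matrix is needed;
  -- it costs nothing as `q ≥ 0`.
  set A : Matrix (Fin n) (Fin n) ℝ := fun i j => ν i j + δ / ‖z‖ * z (i, j) with hA
  have hcoef : 0 ≤ δ / ‖z‖ := by positivity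
  have hA0 : ∀ i j, 0 ≤ A i j := fun i j => by
    have h1 : |z (i, j)| ≤ ‖z‖ := by simpa using PiLp.norm_apply_le z (i, j)
    have h2 : δ / ‖z‖ * (-z (i, j)) ≤ δ / ‖z‖ * ‖z‖ := by
      gcongr; exact (neg_le_abs _).trans h1
    rw [div_mul_cancel₀ _ h.ne'] at h2
    simp only [hA]
    linarith [hδν i j]
  have hrow : ∀ i, ∑ j, A i j ≤ 1 := fun i => by
    have h1 := inner_perpCone_nonpos (toReal q) (rowOnes_mem_cone i)
    rw [inner_rowOnes] at h1
    simp only [hA, Finset.sum_add_distrib, ← Finset.mul_sum, sum_row_of_mem_doublyStochastic hν]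
    linarith [mul_nonpos_of_nonneg_of_nonpos hcoef h1]
  have hcol : ∀ j, ∑ i, A i j ≤ 1 := fun j => by
    have h1 := inner_perpCone_nonpos (toReal q) (colOnes_mem_cone j)
    rw [inner_colOnes] at h1
    simp only [hA, Finset.sum_add_distrib, ← Finset.mul_sum, sum_col_of_mem_doublyStochastic hν]
    linarith [mul_nonpos_of_nonneg_of_nonpos hcoef h1]
  obtain ⟨B, hB, hAB⟩ := exists_doublyStochastic_ge hA0 hrow hcol
  have h1 : inner ℝ (toReal q) (ofMatrix A) ≤ inner ℝ (toReal q) (ofMatrix B) := by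
    simp only [inner_eq_sum, ofMatrix_apply, toReal_apply]
    gcongr with i _ j _
    exact hAB i j
  have h2 : ofMatrix A = ofMatrix ν + (δ / ‖z‖) • z := by
    ext ⟨i, j⟩; exact congrFun₂ hA i j
  rw [h2, inner_add_right, inner_smul_right, hz, inner_perpCone_self, ← hz] at h1
  have h3 : δ / ‖z‖ * ‖z‖ ^ 2 = δ * ‖z‖ := by field_simp
  rw [h3] at h1
  exact h1.trans (inner_le_maxWeight q hB)

/-! #### The projection onto the collapse space -/

/-- The orthogonal projection onto the collapse space. -/
noncomputable abbrev projSpace (n : ℕ) : RealMatrix n →L[ℝ] RealMatrix n :=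
  (collapseSpace n).starProjection

/-- The doubly stochastic matrix with equal entries. -/
noncomputable def uniformMatrix (n : ℕ) : RealMatrix n := WithLp.toLp 2 fun _ => 1 / (n : ℝ)

theorem uniformMatrix_eq (n : ℕ) : uniformMatrix n = (1 / (n : ℝ)) • ∑ i, rowOnes i := by
  ext ⟨i, j⟩
  simp [uniformMatrix, rowOnes]

theorem uniformMatrix_mem (n : ℕ) : uniformMatrix n ∈ collapseSpace n := by
  rw [uniformMatrix_eq]
  exact Submodule.smul_mem _ _ (Submodule.sum_mem _ fun i _ => (rowOnes_mem_cone i).1)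

theorem projSpace_eq_uniformMatrix (hn : 0 < n) {x : RealMatrix n}
    (hrow : ∀ i, ∑ j, x (i, j) = 1) (hcol : ∀ j, ∑ i, x (i, j) = 1) :
    projSpace n x = uniformMatrix n := by
  have hn' : (n : ℝ) ≠ 0 := by positivity
  refine Submodule.eq_starProjection_of_mem_orthogonal (uniformMatrix_mem n) ?_
  refine mem_collapseSpace_orthogonal (fun i => ?_) fun j => ?_
  · simp [uniformMatrix, hrow, hn']
  · simp [uniformMatrix, hcol, hn']

theorem norm_sq_uniformMatrix (hn : 0 < n) : ‖uniformMatrix n‖ ^ 2 = 1 := by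
  have hn' : (n : ℝ) ≠ 0 := by positivity
  rw [norm_sq_eq_sum]
  simp [uniformMatrix]
  field_simp

theorem inner_projSpace_left (x y : RealMatrix n) :
    inner ℝ (projSpace n x) y = inner ℝ x (projSpace n y) :=
  Submodule.inner_starProjection_left_eq_right _ _ _

theorem inner_projSpace_projSpace (x y : RealMatrix n) :
    inner ℝ (projSpace n x) (projSpace n y) = inner ℝ (projSpace n x) y := by
  rw [inner_projSpace_left, inner_projSpace_left]
  congr 1
  exact Submodule.starProjection_eq_self_iff.2 (Submodule.starProjection_apply_mem _ _)

theorem norm_projSpace_le (x : RealMatrix n) : ‖projSpace n x‖ ≤ ‖x‖ :=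
  Submodule.norm_starProjection_apply_le _ _

/-- The cone lies in the collapse space, so the space is at least as near as the cone. -/
theorem norm_sub_projSpace_le (x : RealMatrix n) : ‖x - projSpace n x‖ ≤ ‖perpCone x‖ := by
  have h : projSpace n (projCone x) = projCone x :=
    Submodule.starProjection_eq_self_iff.2 (projCone_mem x).1
  have h2 : x - projSpace n x = (collapseSpace n)ᗮ.starProjection (perpCone x) := by
    rw [Submodule.starProjection_orthogonal_val, perpCone, map_sub, h]
    abel
  rw [h2]
  exact Submodule.norm_starProjection_apply_le _ _

/-- The matrix with a single one. -/
noncomputable def unitMatrix (p : Fin n × Fin n) : RealMatrix n :=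
  WithLp.toLp 2 fun p' => if p'.1 = p.1 ∧ p'.2 = p.2 then 1 else 0

theorem eq_sum_unitMatrix (x : RealMatrix n) : x = ∑ p, x p • unitMatrix p := by
  ext p
  simp [unitMatrix, ← Prod.ext_iff]

/-- This is the source of the constant: `n/2` times the right-hand side is `1 - 1/(2n)`. -/
theorem norm_sq_projSpace_unitMatrix (hn : 0 < n) (p : Fin n × Fin n) :
    ‖projSpace n (unitMatrix p)‖ ^ 2 = (2 * n - 1) / (n : ℝ) ^ 2 := by
  have hn' : (n : ℝ) ≠ 0 := by positivity
  obtain ⟨k, l⟩ := p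
  have h1 : projSpace n (unitMatrix (k, l)) = (1 / (n : ℝ)) • rowOnes k + (1 / (n : ℝ)) • colOnes l
      - (1 / (n : ℝ)) • uniformMatrix n := by
    refine Submodule.eq_starProjection_of_mem_orthogonal ?_ ?_
    · exact Submodule.sub_mem _ (Submodule.add_mem _
        (Submodule.smul_mem _ _ (rowOnes_mem_cone k).1)
        (Submodule.smul_mem _ _ (colOnes_mem_cone l).1))
        (Submodule.smul_mem _ _ (uniformMatrix_mem n))
    · refine mem_collapseSpace_orthogonal (fun i => ?_) fun j => ?_
      · by_cases h : i = k <;>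
          simp [unitMatrix, rowOnes, colOnes, uniformMatrix, h, Finset.sum_sub_distrib,
            Finset.sum_add_distrib, hn']
      · by_cases h : j = l <;>
          simp [unitMatrix, rowOnes, colOnes, uniformMatrix, h, Finset.sum_sub_distrib,
            Finset.sum_add_distrib, hn']
  rw [← real_inner_self_eq_norm_sq, inner_projSpace_projSpace, h1, inner_eq_sum]
  simp only [unitMatrix, ite_and, mul_ite, mul_one, mul_zero, Finset.sum_ite_eq',
    Finset.mem_univ, if_true, Finset.sum_ite_irrel, Finset.sum_const_zero]
  simp [rowOnes, colOnes, uniformMatrix]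
  field_simp
  ring

end Geometry

/-! ### From quadratic drift to exponential moments. -/

section ExponentialDrift

/-- A random variable with bounded distance to `v` whose second moment is at most `v² - δ v + c`
has a geometric drift in its exponential moments. -/
theorem exists_exp_drift {D δ : ℝ} (hD : 0 < D) (hδ : 0 < δ) (c : ℝ) :
    ∃ θ : ℝ, 0 < θ ∧ ∃ γ b : ℝ≥0, γ < 1 ∧ ∀ (Ω : Type u) [MeasurableSpace Ω] (κ : Measure Ω)
      [IsProbabilityMeasure κ] (Z : Ω → ℝ) (v : ℝ), Measurable Z → (∀ ω, |Z ω - v| ≤ D) →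
      ∫ ω, Z ω ^ 2 ∂κ ≤ v ^ 2 - δ * v + c →
      ∫⁻ ω, ENNReal.ofReal (Real.exp (θ * Z ω)) ∂κ
        ≤ γ * ENNReal.ofReal (Real.exp (θ * v)) + b := by
  -- `θD ≤ 1` permits `exp x ≤ 1 + x + x²`, `θD² ≤ δ/8` makes the quadratic term at most half of the
  -- linear gain `θδ/4`, and `θδ ≤ 1` keeps `1 - θδ/8` nonnegative.
  set θ : ℝ := min (1 / D) (min (δ / (8 * D ^ 2)) (1 / δ)) with hθdef
  have hθ : 0 < θ := by positivity
  have hθ1 : θ * D ≤ 1 := by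
    calc θ * D ≤ 1 / D * D := by gcongr; exact min_le_left _ _
      _ = 1 := by field_simp
  have hθ2 : θ * D ^ 2 ≤ δ / 8 := by
    calc θ * D ^ 2 ≤ δ / (8 * D ^ 2) * D ^ 2 := by
          gcongr; exact (min_le_right _ _).trans (min_le_left _ _)
      _ = δ / 8 := by field_simp
  have hθ3 : θ * δ ≤ 1 := by
    calc θ * δ ≤ 1 / δ * δ := by gcongr; exact (min_le_right _ _).trans (min_le_right _ _)
      _ = 1 := by field_simp
  -- Above `B` the constant `c` uses up at most half of the drift `δv`; below `B` the exponential is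
  -- simply bounded.
  set B : ℝ := 2 * |c| / δ + 1 with hB
  have hBpos : 0 < B := by positivity
  refine ⟨θ, hθ, (1 - θ * δ / 8).toNNReal, (Real.exp (θ * (B + D))).toNNReal, ?_, ?_⟩
  · rw [Real.toNNReal_lt_one]
    have : 0 < θ * δ := by positivity
    linarith
  intro Ω _ κ _ Z v hZ hZv hdrift
  rw [← ENNReal.ofReal, ← ENNReal.ofReal]
  have hinteg : ∀ {f : Ω → ℝ}, Measurable f → ∀ C, (∀ ω, |f ω| ≤ C) → Integrable f κ :=
    fun hf C hC => Integrable.of_bound hf.aestronglyMeasurable C (ae_of_all _ hC)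
  rcases le_or_gt v B with hv | hv
  · refine le_trans ?_ le_add_self
    calc _ ≤ ∫⁻ ω, ENNReal.ofReal (Real.exp (θ * (B + D))) ∂κ := by
          refine lintegral_mono fun ω => ?_
          gcongr
          have := (abs_le.1 (hZv ω)).2
          linarith
      _ = _ := by simp
  · refine le_trans ?_ le_self_add
    have hvpos : 0 < v := hBpos.trans hv
    have hc : c ≤ δ * v / 2 := by
      have h1 : |c| ≤ δ * B / 2 := by
        rw [hB]; field_simp; nlinarith
      nlinarith [le_abs_self c]
    have hΔ : Integrable (fun ω => Z ω - v) κ := hinteg (hZ.sub_const v) D hZv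
    have haff : ∀ c k : ℝ, Integrable (fun ω => c + k * (Z ω - v)) κ := fun c k =>
      (integrable_const c).add (hΔ.const_mul k)
    have haff' : ∀ c k : ℝ, ∫ ω, (c + k * (Z ω - v)) ∂κ = c + k * ∫ ω, (Z ω - v) ∂κ := fun c k => by
      rw [integral_add (integrable_const c) (hΔ.const_mul k), integral_const_mul]
      simp
    have hsq : Integrable (fun ω => Z ω ^ 2) κ := by
      refine hinteg (hZ.pow_const 2) ((|v| + D) ^ 2) fun ω => ?_
      rw [abs_pow]
      gcongr
      calc |Z ω| = |v + (Z ω - v)| := by ring_nf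
        _ ≤ |v| + |Z ω - v| := abs_add_le _ _
        _ ≤ _ := by gcongr; exact hZv ω
    -- From `Z² ≥ v² + 2v(Z - v)`, the drift of the square yields a drift of `Z` itself.
    have hmean : ∫ ω, (Z ω - v) ∂κ ≤ -(δ / 4) := by
      have h1 : ∫ ω, (v ^ 2 + 2 * v * (Z ω - v)) ∂κ ≤ ∫ ω, Z ω ^ 2 ∂κ :=
        integral_mono (haff _ _) hsq fun ω => by
          nlinarith [sq_nonneg (Z ω - v)]
      rw [haff'] at h1
      have h2 : v * (2 * ∫ ω, (Z ω - v) ∂κ) ≤ v * (-(δ / 2)) := by linarith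
      linarith [le_of_mul_le_mul_left h2 hvpos]
    have hpt : ∀ ω, Real.exp (θ * Z ω)
        ≤ Real.exp (θ * v) * (1 + θ * (Z ω - v) + θ ^ 2 * D ^ 2) := fun ω => by
      have h1 : |θ * (Z ω - v)| ≤ 1 := by
        rw [abs_mul, abs_of_pos hθ]
        exact (mul_le_mul_of_nonneg_left (hZv ω) hθ.le).trans hθ1
      have h2 := Real.abs_exp_sub_one_sub_id_le h1
      have h3 : (θ * (Z ω - v)) ^ 2 ≤ θ ^ 2 * D ^ 2 := by
        rw [mul_pow]
        gcongr ?_ * ?_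
        exact sq_le_sq' (by linarith [(abs_le.1 (hZv ω)).1]) (abs_le.1 (hZv ω)).2
      rw [show θ * Z ω = θ * v + θ * (Z ω - v) by ring, Real.exp_add]
      gcongr
      linarith [(abs_le.1 h2).2]
    have hI : Integrable (fun ω => Real.exp (θ * v) * (1 + θ * (Z ω - v) + θ ^ 2 * D ^ 2)) κ :=
      ((haff 1 θ).add (integrable_const _)).const_mul _
    have hIexp : Integrable (fun ω => Real.exp (θ * Z ω)) κ :=
      hI.mono' (by fun_prop) (ae_of_all _ fun ω => by
        rw [Real.norm_of_nonneg (Real.exp_pos _).le]; exact hpt ω)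
    rw [← ofReal_integral_eq_lintegral_ofReal hIexp (ae_of_all _ fun ω => (Real.exp_pos _).le),
      ← ENNReal.ofReal_mul (by linarith)]
    apply ENNReal.ofReal_le_ofReal
    calc _ ≤ _ := integral_mono hIexp hI hpt
      _ = Real.exp (θ * v) * (1 + θ * (∫ ω, (Z ω - v) ∂κ) + θ ^ 2 * D ^ 2) := by
          rw [integral_const_mul, integral_add (haff 1 θ) (integrable_const _), haff']
          simp
      _ ≤ Real.exp (θ * v) * (1 - θ * δ / 8) := by
          gcongr
          nlinarith
      _ = _ := mul_comm _ _

end ExponentialDrift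

/-! ### One slot from a fixed state: the three quadratic drifts. -/

section OneStep

variable {n : ℕ}

/-- The queue lengths `[q + a - s]⁺` after one slot. -/
def nextQueue (q a s : PacketMatrix n) : PacketMatrix n := fun i j => q i j + a i j - s i j

/-- The unused service. -/
def unused (q a s : PacketMatrix n) : PacketMatrix n := fun i j => s i j - (q i j + a i j)

theorem toReal_nextQueue (q a s : PacketMatrix n) :
    toReal (nextQueue q a s) = toReal q + toReal a - toReal s + toReal (unused q a s) := by
  ext ⟨i, j⟩
  simp only [toReal_apply, nextQueue, unused, PiLp.add_apply, PiLp.sub_apply]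
  have : ((q i j + a i j - s i j : ℕ) : ℤ)
      = q i j + a i j - s i j + (s i j - (q i j + a i j) : ℕ) := by
    omega
  exact_mod_cast this

theorem nextQueue_mul_unused (q a s : PacketMatrix n) (i j : Fin n) :
    nextQueue q a s i j * unused q a s i j = 0 := by
  simp only [nextQueue, unused, mul_eq_zero]
  omega

/-- Complementarity: service is wasted only at a queue that ends the slot empty. -/
theorem inner_nextQueue_unused (q a s : PacketMatrix n) :
    inner ℝ (toReal (nextQueue q a s)) (toReal (unused q a s)) = 0 := by
  rw [inner_eq_sum]
  refine Finset.sum_eq_zero fun i _ => Finset.sum_eq_zero fun j _ => ?_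
  simp only [toReal_apply]
  exact_mod_cast nextQueue_mul_unused q a s i j

/-- The total number of packets. -/
noncomputable def total (q : PacketMatrix n) : ℝ := ∑ i, ∑ j, (q i j : ℝ)

theorem total_nonneg (q : PacketMatrix n) : 0 ≤ total q := by unfold total; positivity

theorem norm_le_total (q : PacketMatrix n) : ‖toReal q‖ ≤ total q := by
  refine (sq_le_sq₀ (norm_nonneg _) (total_nonneg q)).1 ?_
  have hle : ∀ i j, (q i j : ℝ) ≤ total q := fun i j =>
    (Finset.single_le_sum (f := fun j => (q i j : ℝ)) (fun _ _ => by positivity)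
      (Finset.mem_univ j)).trans
    (Finset.single_le_sum (f := fun i => ∑ j, (q i j : ℝ)) (fun _ _ => by positivity)
      (Finset.mem_univ i))
  rw [norm_sq_eq_sum, sq (total q)]
  conv_rhs => rw [total, Finset.sum_mul]
  refine Finset.sum_le_sum fun i _ => ?_
  rw [Finset.sum_mul]
  refine Finset.sum_le_sum fun j _ => ?_
  rw [toReal_apply, sq]
  gcongr
  exact hle i j

theorem norm_sq_unused {q a s : PacketMatrix n} (hs : s ∈ schedules n) :
    ‖toReal (unused q a s)‖ ^ 2 = total (unused q a s) := by
  rw [norm_sq_eq_sum, total]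
  refine Finset.sum_congr rfl fun i _ => Finset.sum_congr rfl fun j _ => ?_
  have h1 : unused q a s i j ≤ 1 := (Nat.sub_le _ _).trans (le_one_of_mem_schedules hs i j)
  rw [toReal_apply]
  interval_cases h : unused q a s i j <;> simp

theorem total_of_mem_schedules {s : PacketMatrix n} (hs : s ∈ schedules n) : total s = n := by
  simp [total, sum_row_of_mem_schedules hs]

theorem inner_uniformMatrix (x : RealMatrix n) :
    inner ℝ x (uniformMatrix n) = (∑ i, ∑ j, x (i, j)) / n := by
  rw [inner_eq_sum]
  simp [uniformMatrix, div_eq_mul_inv, Finset.sum_mul]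

theorem norm_sq_le_of_abs_le {x : RealMatrix n} {C : ℝ} (h : ∀ i j, |x (i, j)| ≤ C) :
    ‖x‖ ^ 2 ≤ (n * C) ^ 2 := by
  rw [norm_sq_eq_sum]
  calc _ ≤ ∑ _i : Fin n, ∑ _j : Fin n, C ^ 2 := by
        refine Finset.sum_le_sum fun i _ => Finset.sum_le_sum fun j _ => ?_
        rw [← sq_abs]
        gcongr
        exact h i j
    _ = _ := by simp; ring

variable {amax : ℕ} {a s : PacketMatrix n}

theorem norm_sq_arrival_sub_schedule_le (ha : ∀ i j, a i j ≤ amax) (hs : s ∈ schedules n) :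
    ‖toReal a - toReal s‖ ^ 2 ≤ (n * (amax + 1 : ℝ)) ^ 2 := by
  refine norm_sq_le_of_abs_le fun i j => ?_
  have h1 : (a i j : ℝ) ≤ amax := by exact_mod_cast ha i j
  have h2 : (s i j : ℝ) ≤ 1 := by exact_mod_cast le_one_of_mem_schedules hs i j
  have h3 : (0 : ℝ) ≤ a i j := by positivity
  have h4 : (0 : ℝ) ≤ s i j := by positivity
  simp only [PiLp.sub_apply, toReal_apply]
  rw [abs_le]; constructor <;> linarith

theorem norm_nextQueue_sub_le (q : PacketMatrix n) (ha : ∀ i j, a i j ≤ amax)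
    (hs : s ∈ schedules n) : ‖toReal (nextQueue q a s) - toReal q‖ ≤ n * (amax + 1 : ℝ) := by
  refine (sq_le_sq₀ (norm_nonneg _) (by positivity)).1 (norm_sq_le_of_abs_le fun i j => ?_)
  have h1 := ha i j
  have h2 := le_one_of_mem_schedules hs i j
  have h3 : |((nextQueue q a s i j : ℕ) : ℤ) - q i j| ≤ amax + 1 := by
    simp only [nextQueue]
    rw [abs_le]; omega
  simp only [PiLp.sub_apply, toReal_apply]
  exact_mod_cast h3

theorem norm_sq_nextQueue_le (q a s : PacketMatrix n) :
    ‖toReal (nextQueue q a s)‖ ^ 2 ≤ ‖toReal q + toReal a - toReal s‖ ^ 2 := by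
  have h1 := toReal_nextQueue q a s
  have h2 : toReal q + toReal a - toReal s = toReal (nextQueue q a s) - toReal (unused q a s) := by
    rw [h1]; abel
  rw [h2, norm_sub_sq_real, inner_nextQueue_unused]
  nlinarith [sq_nonneg ‖toReal (unused q a s)‖]

theorem norm_sq_add_arrival_sub_schedule_le (q : PacketMatrix n) (ha : ∀ i j, a i j ≤ amax)
    (hs : s ∈ schedules n) :
    ‖toReal q + toReal a - toReal s‖ ^ 2
      ≤ ‖toReal q‖ ^ 2 + 2 * (inner ℝ (toReal q) (toReal a) - weight q s)
        + (n * (amax + 1 : ℝ)) ^ 2 := by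
  rw [add_sub_assoc, norm_add_sq_real, inner_sub_right, weight_eq_inner]
  linarith [norm_sq_arrival_sub_schedule_le ha hs]

theorem inner_schedule_eq {x : RealMatrix n} (hx : x ∈ collapseSpace n) (hs : s ∈ schedules n)
    {ν : Matrix (Fin n) (Fin n) ℝ} (hν : ν ∈ doublyStochastic ℝ (Fin n)) :
    inner ℝ x (toReal s) = inner ℝ x (ofMatrix ν) := by
  have h : toReal s - ofMatrix ν ∈ (collapseSpace n)ᗮ :=
    mem_collapseSpace_orthogonal
      (fun i => by simp [sum_row_of_mem_schedules hs, sum_row_of_mem_doublyStochastic hν])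
      (fun j => by simp [sum_col_of_mem_schedules hs, sum_col_of_mem_doublyStochastic hν])
  have := (Submodule.mem_orthogonal _ _).1 h x hx
  rw [inner_sub_right] at this
  linarith

/-- By Pythagoras the change is that of `‖q‖²` minus that of `‖projCone q‖²`, and the latter is
bounded below by the subgradient inequality. Unused service only helps there, as the cone is
nonnegative, and a schedule acts on the cone as `ν` does. -/
theorem norm_sq_perpCone_nextQueue_le (q : PacketMatrix n) (ha : ∀ i j, a i j ≤ amax)
    (hs : s ∈ schedules n) {ν : Matrix (Fin n) (Fin n) ℝ} (hν : ν ∈ doublyStochastic ℝ (Fin n)) :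
    ‖perpCone (toReal (nextQueue q a s))‖ ^ 2 ≤ ‖perpCone (toReal q)‖ ^ 2
      + 2 * (inner ℝ (perpCone (toReal q)) (toReal a)
        + inner ℝ (projCone (toReal q)) (ofMatrix ν) - weight q s) + (n * (amax + 1 : ℝ)) ^ 2 := by
  have h1 := norm_sq_eq_projCone_add_perpCone (toReal q)
  have h2 := norm_sq_eq_projCone_add_perpCone (toReal (nextQueue q a s))
  have h3 := two_mul_inner_projCone_le (toReal q) (toReal (nextQueue q a s))
  have h4 : toReal (nextQueue q a s) - toReal q
      = toReal a - toReal s + toReal (unused q a s) := by rw [toReal_nextQueue]; abel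
  have h5 : 0 ≤ inner ℝ (projCone (toReal q)) (toReal (unused q a s)) := by
    rw [inner_eq_sum]
    refine Finset.sum_nonneg fun i _ => Finset.sum_nonneg fun j _ => ?_
    exact mul_nonneg ((projCone_mem _).2 _) (by simp)
  have h6 : inner ℝ (toReal q) (toReal a)
      = inner ℝ (projCone (toReal q)) (toReal a) + inner ℝ (perpCone (toReal q)) (toReal a) := by
    rw [← inner_add_left, projCone_add_perpCone]
  rw [h4, inner_add_right, inner_sub_right, inner_schedule_eq (projCone_mem _).1 hs hν] at h3
  linarith [norm_sq_nextQueue_le q a s, norm_sq_add_arrival_sub_schedule_le q ha hs]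

/-- The change of the squared norm of the projection onto the collapse space in one slot; the last
term comes from the unused service. -/
theorem norm_sq_projSpace_nextQueue (hn : 0 < n) (q a : PacketMatrix n) (hs : s ∈ schedules n) :
    ‖projSpace n (toReal (nextQueue q a s))‖ ^ 2
      = ‖projSpace n (toReal q)‖ ^ 2
        + 2 * (inner ℝ (projSpace n (toReal q)) (toReal a) - total q / n)
        + ‖projSpace n (toReal a) - uniformMatrix n‖ ^ 2
        - (2 * inner ℝ (toReal (nextQueue q a s) - projSpace n (toReal (nextQueue q a s)))
              (toReal (unused q a s))
            + ‖projSpace n (toReal (unused q a s))‖ ^ 2) := by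
  have hsu : projSpace n (toReal s) = uniformMatrix n :=
    projSpace_eq_uniformMatrix hn (sum_row_of_mem_schedules hs) (sum_col_of_mem_schedules hs)
  set A := projSpace n (toReal q) + (projSpace n (toReal a) - uniformMatrix n) with hA
  set U := projSpace n (toReal (unused q a s)) with hU
  have h1 : projSpace n (toReal (nextQueue q a s)) = A + U := by
    rw [toReal_nextQueue, map_add, map_sub, map_add, hsu]
    simp only [hA, hU]; abel
  -- By complementarity the cross term involves only the component of the next queue orthogonal to
  -- the collapse space, which state-space collapse controls.
  have h2 : inner ℝ (projSpace n (toReal (nextQueue q a s))) U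
      = -inner ℝ (toReal (nextQueue q a s) - projSpace n (toReal (nextQueue q a s)))
          (toReal (unused q a s)) := by
    rw [hU, inner_projSpace_projSpace, inner_sub_left, inner_nextQueue_unused]
    ring
  have h3 : inner ℝ (projSpace n (toReal q)) (projSpace n (toReal a) - uniformMatrix n)
      = inner ℝ (projSpace n (toReal q)) (toReal a) - total q / n := by
    rw [inner_sub_right, inner_projSpace_projSpace, inner_projSpace_left _ (uniformMatrix n),
      Submodule.starProjection_eq_self_iff.2 (uniformMatrix_mem n), inner_uniformMatrix]
    rfl
  have h4 : ‖A + U‖ ^ 2 = ‖A‖ ^ 2 + 2 * inner ℝ (A + U) U - ‖U‖ ^ 2 := by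
    rw [norm_add_sq_real, inner_add_left A U U, real_inner_self_eq_norm_sq]; ring
  rw [← h1, h2] at h4
  rw [h4, hA, norm_add_sq_real, h3]
  ring

/-- Young's inequality with free weight `η`. Unused service has entries `0` or `1`, so its squared
norm is its total. -/
theorem abs_unused_error_le {q : PacketMatrix n} (hs : s ∈ schedules n) {η : ℝ} (hη : 0 < η) :
    |2 * inner ℝ (toReal (nextQueue q a s) - projSpace n (toReal (nextQueue q a s)))
          (toReal (unused q a s)) + ‖projSpace n (toReal (unused q a s))‖ ^ 2|
      ≤ η * ‖perpCone (toReal (nextQueue q a s))‖ ^ 2 + (1 / η + 1) * total (unused q a s) := by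
  rw [← norm_sq_unused hs]
  set w := toReal (nextQueue q a s)
  set u := toReal (unused q a s)
  have h1 : |inner ℝ (w - projSpace n w) u| ≤ ‖perpCone w‖ * ‖u‖ :=
    (abs_real_inner_le_norm _ _).trans (by gcongr; exact norm_sub_projSpace_le w)
  have h2 : ‖projSpace n u‖ ^ 2 ≤ ‖u‖ ^ 2 := by gcongr; exact norm_projSpace_le u
  have h3 : 2 * (‖perpCone w‖ * ‖u‖) ≤ η * ‖perpCone w‖ ^ 2 + 1 / η * ‖u‖ ^ 2 := by
    have h : η * ‖perpCone w‖ ^ 2 + 1 / η * ‖u‖ ^ 2 - 2 * (‖perpCone w‖ * ‖u‖)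
        = (η * ‖perpCone w‖ - ‖u‖) ^ 2 / η := by field_simp; ring
    have : 0 ≤ (η * ‖perpCone w‖ - ‖u‖) ^ 2 / η := by positivity
    linarith
  have h4 := abs_le.1 h1
  rw [abs_le]
  constructor <;> nlinarith [sq_nonneg ‖projSpace n u‖]

/-- One slot of a switch that starts with queue lengths `q`: the law of the schedule and of the
arrivals, with mean arrivals `(1 - ε) ν` and uncorrelated arrivals with variances `var`, where the
schedule has nearly the largest weight. -/
structure OneStep (Ω : Type u) [MeasurableSpace Ω] (q : PacketMatrix n) (amax : ℕ) (W ε : ℝ)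
    (ν : Matrix (Fin n) (Fin n) ℝ) (var : Fin n × Fin n → ℝ) where
  κ : Measure Ω
  isProb : IsProbabilityMeasure κ
  a : Ω → PacketMatrix n
  s : Ω → PacketMatrix n
  measurable_a : Measurable a
  measurable_s : Measurable s
  s_mem : ∀ ω, s ω ∈ schedules n
  a_le : ∀ ω i j, a ω i j ≤ amax
  mean : ∀ p, ∫ ω, toReal (a ω) p ∂κ = (1 - ε) * ofMatrix ν p
  cov : ∀ p p', ∫ ω, (toReal (a ω) p - (1 - ε) * ofMatrix ν p)
    * (toReal (a ω) p' - (1 - ε) * ofMatrix ν p') ∂κ = if p = p' then var p else 0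
  maxWeight_le : (maxWeight q : ℝ) - W ≤ ∫ ω, (weight q (s ω) : ℝ) ∂κ

attribute [instance] OneStep.isProb

namespace OneStep

variable {Ω : Type u} [MeasurableSpace Ω] {q : PacketMatrix n} {amax : ℕ} {W ε : ℝ}
  {ν : Matrix (Fin n) (Fin n) ℝ} {var : Fin n × Fin n → ℝ}

/-- The queue lengths after the slot. -/
def next (O : OneStep Ω q amax W ε ν var) (ω : Ω) : PacketMatrix n := nextQueue q (O.a ω) (O.s ω)

/-- The unused service of the slot. -/
def idle (O : OneStep Ω q amax W ε ν var) (ω : Ω) : PacketMatrix n := unused q (O.a ω) (O.s ω)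

variable (O : OneStep Ω q amax W ε ν var)

theorem measurable_comp {E : Type*} [MeasurableSpace E] (F : PacketMatrix n → PacketMatrix n → E) :
    Measurable fun ω => F (O.a ω) (O.s ω) :=
  (measurable_of_countable fun r : PacketMatrix n × PacketMatrix n => F r.1 r.2).comp
    (O.measurable_a.prodMk O.measurable_s)

/-- Only finitely many pairs of arrivals and schedules occur. -/
theorem integrable_comp (F : PacketMatrix n → PacketMatrix n → ℝ) :
    Integrable (fun ω => F (O.a ω) (O.s ω)) O.κ := by
  have h1 : (Set.Iic (fun _ _ => amax : PacketMatrix n)).Finite := Set.finite_Iic _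
  have h2 : (schedules n).Finite := Set.finite_range _
  obtain ⟨C, hC⟩ := ((h1.prod h2).image fun r => |F r.1 r.2|).bddAbove
  refine Integrable.of_bound (O.measurable_comp F).aestronglyMeasurable C (ae_of_all _ fun ω => ?_)
  exact hC ⟨(O.a ω, O.s ω), ⟨fun i j => O.a_le ω i j, O.s_mem ω⟩, rfl⟩

theorem integral_inner_arrival (x : RealMatrix n) :
    ∫ ω, inner ℝ x (toReal (O.a ω)) ∂O.κ = (1 - ε) * inner ℝ x (ofMatrix ν) := by
  simp only [inner_eq_sum]
  rw [integral_finsetSum _ fun i _ => O.integrable_comp fun a _ => ∑ j, x (i, j) * toReal a (i, j),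
    Finset.mul_sum]
  refine Finset.sum_congr rfl fun i _ => ?_
  rw [integral_finsetSum _ fun j _ => O.integrable_comp fun a _ => x (i, j) * toReal a (i, j),
    Finset.mul_sum]
  refine Finset.sum_congr rfl fun j _ => ?_
  rw [integral_const_mul, O.mean]
  ring

/-- The drift coefficient vanishes with `ε`, so this serves for stability at each fixed `ε` and not
for uniform bounds. -/
theorem integral_norm_sq_next_le (hν : ν ∈ doublyStochastic ℝ (Fin n)) {δ : ℝ}
    (hδν : ∀ i j, δ ≤ ν i j) (hε0 : 0 ≤ ε) (hδ : 0 ≤ δ) :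
    ∫ ω, ‖toReal (O.next ω)‖ ^ 2 ∂O.κ ≤ ‖toReal q‖ ^ 2 - 2 * ε * δ * ‖toReal q‖
      + (2 * W + (n * (amax + 1 : ℝ)) ^ 2) := by
  have h1 : ∫ ω, ‖toReal (O.next ω)‖ ^ 2 ∂O.κ
      ≤ ∫ ω, (‖toReal q‖ ^ 2 + (n * (amax + 1 : ℝ)) ^ 2 + 2 * inner ℝ (toReal q) (toReal (O.a ω))
        - 2 * weight q (O.s ω)) ∂O.κ := by
    refine integral_mono (O.integrable_comp fun a s => ‖toReal (nextQueue q a s)‖ ^ 2)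
      (O.integrable_comp fun a s => ‖toReal q‖ ^ 2 + (n * (amax + 1 : ℝ)) ^ 2
        + 2 * inner ℝ (toReal q) (toReal a) - 2 * weight q s) fun ω => ?_
    have h2 := norm_sq_nextQueue_le q (O.a ω) (O.s ω)
    have h3 := norm_sq_add_arrival_sub_schedule_le q (O.a_le ω) (O.s_mem ω)
    simp only [next]
    linarith
  rw [integral_sub (O.integrable_comp fun a s => ‖toReal q‖ ^ 2 + (n * (amax + 1 : ℝ)) ^ 2
      + 2 * inner ℝ (toReal q) (toReal a)) (O.integrable_comp fun a s => 2 * (weight q s : ℝ)),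
    integral_add (integrable_const _) (O.integrable_comp fun a s =>
      2 * inner ℝ (toReal q) (toReal a)), integral_const_mul, integral_const_mul,
    O.integral_inner_arrival] at h1
  simp only [integral_const, probReal_univ, one_smul] at h1
  have h4 := O.maxWeight_le
  have h5 := inner_le_maxWeight q hν
  have h6 : δ * ‖toReal q‖ ≤ inner ℝ (toReal q) (ofMatrix ν) := by
    calc δ * ‖toReal q‖ ≤ δ * total q := by gcongr; exact norm_le_total q
      _ = ∑ i, ∑ j, (q i j : ℝ) * δ := by simp only [total, Finset.mul_sum, mul_comm]
      _ ≤ _ := by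
        rw [inner_eq_sum]
        simp only [toReal_apply, ofMatrix_apply]
        gcongr with i _ j _
        exact hδν i j
  nlinarith [mul_le_mul_of_nonneg_left h6 hε0]

/-- The excess of the largest weight gives `-2δ‖z‖`, of which the load reduction `ε` costs at most
half; the rest does not depend on `ε`. -/
theorem integral_norm_sq_perpCone_next_le (hν : ν ∈ doublyStochastic ℝ (Fin n)) {δ : ℝ}
    (hδ : 0 ≤ δ) (hδν : ∀ i j, δ ≤ ν i j) (hε0 : 0 ≤ ε) (hε : ε * ‖ofMatrix ν‖ ≤ δ / 2) :
    ∫ ω, ‖perpCone (toReal (O.next ω))‖ ^ 2 ∂O.κ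
      ≤ ‖perpCone (toReal q)‖ ^ 2 - δ * ‖perpCone (toReal q)‖
        + (2 * W + (n * (amax + 1 : ℝ)) ^ 2) := by
  set z := perpCone (toReal q) with hz
  set C : ℝ := ‖z‖ ^ 2 + (n * (amax + 1 : ℝ)) ^ 2
    + 2 * inner ℝ (projCone (toReal q)) (ofMatrix ν) with hC
  have h1 : ∫ ω, ‖perpCone (toReal (O.next ω))‖ ^ 2 ∂O.κ
      ≤ ∫ ω, (C + 2 * inner ℝ z (toReal (O.a ω)) - 2 * weight q (O.s ω)) ∂O.κ := by
    refine integral_mono (O.integrable_comp fun a s => ‖perpCone (toReal (nextQueue q a s))‖ ^ 2)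
      (O.integrable_comp fun a s => C + 2 * inner ℝ z (toReal a) - 2 * weight q s) fun ω => ?_
    have h2 := norm_sq_perpCone_nextQueue_le q (O.a_le ω) (O.s_mem ω) hν
    simp only [next, hC, hz]
    linarith
  rw [integral_sub (O.integrable_comp fun a s => C + 2 * inner ℝ z (toReal a))
      (O.integrable_comp fun a s => 2 * (weight q s : ℝ)),
    integral_add (integrable_const _) (O.integrable_comp fun a s => 2 * inner ℝ z (toReal a)),
    integral_const_mul, integral_const_mul, O.integral_inner_arrival] at h1
  simp only [integral_const, probReal_univ, one_smul] at h1
  have h4 := O.maxWeight_le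
  have h5 := inner_add_mul_norm_perpCone_le_maxWeight q hν hδ hδν
  have h6 : inner ℝ (toReal q) (ofMatrix ν)
      = inner ℝ (projCone (toReal q)) (ofMatrix ν) + inner ℝ z (ofMatrix ν) := by
    rw [← inner_add_left, hz, projCone_add_perpCone]
  have h7 : -inner ℝ z (ofMatrix ν) ≤ ‖z‖ * ‖ofMatrix ν‖ :=
    (neg_le_abs _).trans (abs_real_inner_le_norm _ _)
  have h8 : ε * (-inner ℝ z (ofMatrix ν)) ≤ δ / 2 * ‖z‖ := by
    calc _ ≤ ε * (‖z‖ * ‖ofMatrix ν‖) := by gcongr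
      _ = ε * ‖ofMatrix ν‖ * ‖z‖ := by ring
      _ ≤ _ := by gcongr
  rw [← hz] at h5
  linarith

/-- Mean arrivals total `n(1 - ε)` against service `n`. In steady state this forces the mean unused
service to be `nε`. -/
theorem integral_total_next (hν : ν ∈ doublyStochastic ℝ (Fin n)) :
    ∫ ω, total (O.next ω) ∂O.κ = total q - n * ε + ∫ ω, total (O.idle ω) ∂O.κ := by
  set e : RealMatrix n := WithLp.toLp 2 fun _ => 1 with he
  have h1 : ∀ ω, total (O.next ω)
      = (total q - n) + inner ℝ e (toReal (O.a ω)) + total (O.idle ω) := fun ω => by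
    have h2 : total (O.next ω) = total q + total (O.a ω) - total (O.s ω) + total (O.idle ω) := by
      simp only [total, ← Finset.sum_add_distrib, ← Finset.sum_sub_distrib]
      refine Finset.sum_congr rfl fun i _ => Finset.sum_congr rfl fun j _ => ?_
      exact congrArg (fun x : RealMatrix n => x (i, j)) (toReal_nextQueue q (O.a ω) (O.s ω))
    rw [h2, total_of_mem_schedules (O.s_mem ω), inner_eq_sum]
    simp only [he, toReal_apply, one_mul, total]
    ring
  simp only [h1]
  rw [integral_add (O.integrable_comp fun a _ => (total q - n) + inner ℝ e (toReal a))
      (show Integrable (fun ω => total (O.idle ω)) O.κ from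
        O.integrable_comp fun a s => total (unused q a s)),
    integral_add (integrable_const _) (O.integrable_comp fun a _ => inner ℝ e (toReal a)),
    O.integral_inner_arrival, inner_eq_sum]
  simp [he, sum_row_of_mem_doublyStochastic hν]
  ring

/-- Since `ν` projects to the uniform matrix, centring the arrivals leaves a multiple `-ε` of it, of
squared norm `ε²`. Uncorrelated entries leave only the diagonal of the quadratic form. -/
theorem integral_norm_sq_projSpace_arrival (hn : 0 < n) (hν : ν ∈ doublyStochastic ℝ (Fin n)) :
    ∫ ω, ‖projSpace n (toReal (O.a ω)) - uniformMatrix n‖ ^ 2 ∂O.κ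
      = (2 * n - 1) / (n : ℝ) ^ 2 * ∑ p, var p + ε ^ 2 := by
  set J := uniformMatrix n with hJ
  set Z : PacketMatrix n → RealMatrix n := fun a => toReal a - (1 - ε) • ofMatrix ν with hZ
  have hprojν : projSpace n (ofMatrix ν) = J :=
    projSpace_eq_uniformMatrix hn (sum_row_of_mem_doublyStochastic hν)
      (sum_col_of_mem_doublyStochastic hν)
  have hprojJ : projSpace n J = J := Submodule.starProjection_eq_self_iff.2 (uniformMatrix_mem n)
  have h1 : ∀ a : PacketMatrix n, ‖projSpace n (toReal a) - J‖ ^ 2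
      = ‖projSpace n (Z a)‖ ^ 2 - 2 * ε * (inner ℝ J (toReal a) - (1 - ε) * inner ℝ J (ofMatrix ν))
        + ε ^ 2 := fun a => by
    have h2 : projSpace n (toReal a) - J = projSpace n (Z a) - ε • J := by
      rw [hZ, map_sub, map_smul, hprojν]
      module
    rw [h2, norm_sub_sq_real, inner_smul_right, inner_projSpace_left, hprojJ, norm_smul, mul_pow,
      norm_sq_uniformMatrix hn, hZ, inner_sub_left, inner_smul_left, real_inner_comm J,
      real_inner_comm J (ofMatrix ν), Real.norm_eq_abs, sq_abs]
    simp
    ring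
  have h3 : ∀ a : PacketMatrix n, ‖projSpace n (Z a)‖ ^ 2
      = ∑ p, ∑ p', inner ℝ (projSpace n (unitMatrix p)) (projSpace n (unitMatrix p'))
          * (Z a p * Z a p') := fun a => by
    rw [← real_inner_self_eq_norm_sq]
    conv_lhs => rw [eq_sum_unitMatrix (Z a)]
    simp only [map_sum, map_smul, sum_inner, inner_sum, inner_smul_left, inner_smul_right]
    rw [Finset.sum_comm]
    refine Finset.sum_congr rfl fun p _ => ?_
    rw [Finset.mul_sum]
    refine Finset.sum_congr rfl fun p' _ => ?_
    rw [starRingEnd_apply, star_trivial]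
    ring
  have h4 : ∫ ω, ‖projSpace n (Z (O.a ω))‖ ^ 2 ∂O.κ = (2 * n - 1) / (n : ℝ) ^ 2 * ∑ p, var p := by
    simp only [h3]
    rw [integral_finsetSum _ fun p _ => O.integrable_comp fun a _ =>
      ∑ p', inner ℝ (projSpace n (unitMatrix p)) (projSpace n (unitMatrix p'))
          * (Z a p * Z a p'), Finset.mul_sum]
    refine Finset.sum_congr rfl fun p _ => ?_
    rw [integral_finsetSum _ fun p' _ => O.integrable_comp fun a _ =>
      inner ℝ (projSpace n (unitMatrix p)) (projSpace n (unitMatrix p')) * (Z a p * Z a p')]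
    have h5 : ∀ p', ∫ ω, Z (O.a ω) p * Z (O.a ω) p' ∂O.κ = if p = p' then var p else 0 :=
      fun p' => O.cov p p'
    simp only [integral_const_mul, h5, mul_ite, mul_zero, Finset.sum_ite_eq, Finset.mem_univ,
      if_true]
    rw [real_inner_self_eq_norm_sq, norm_sq_projSpace_unitMatrix hn]
  simp only [h1]
  rw [integral_add (O.integrable_comp fun a _ => ‖projSpace n (Z a)‖ ^ 2
        - 2 * ε * (inner ℝ J (toReal a) - (1 - ε) * inner ℝ J (ofMatrix ν))) (integrable_const _),
    integral_sub (O.integrable_comp fun a _ => ‖projSpace n (Z a)‖ ^ 2)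
      (O.integrable_comp fun a _ =>
        2 * ε * (inner ℝ J (toReal a) - (1 - ε) * inner ℝ J (ofMatrix ν))), h4, integral_const_mul,
    integral_sub (O.integrable_comp fun a _ => inner ℝ J (toReal a)) (integrable_const _),
    O.integral_inner_arrival]
  simp

theorem abs_integral_norm_sq_projSpace_next_sub_le (hn : 0 < n)
    (hν : ν ∈ doublyStochastic ℝ (Fin n)) {η : ℝ} (hη : 0 < η) :
    |∫ ω, ‖projSpace n (toReal (O.next ω))‖ ^ 2 ∂O.κ
        - (‖projSpace n (toReal q)‖ ^ 2 - 2 * ε * total q / n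
          + ((2 * n - 1) / (n : ℝ) ^ 2 * ∑ p, var p + ε ^ 2))|
      ≤ η * ∫ ω, ‖perpCone (toReal (O.next ω))‖ ^ 2 ∂O.κ
        + (1 / η + 1) * ∫ ω, total (O.idle ω) ∂O.κ := by
  set Er : PacketMatrix n → PacketMatrix n → ℝ := fun a s =>
    2 * inner ℝ (toReal (nextQueue q a s) - projSpace n (toReal (nextQueue q a s)))
      (toReal (unused q a s)) + ‖projSpace n (toReal (unused q a s))‖ ^ 2 with hEr
  have h1 : ∀ ω, ‖projSpace n (toReal (O.next ω))‖ ^ 2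
      = (‖projSpace n (toReal q)‖ ^ 2 - 2 * total q / n)
        + 2 * inner ℝ (projSpace n (toReal q)) (toReal (O.a ω))
        + ‖projSpace n (toReal (O.a ω)) - uniformMatrix n‖ ^ 2 - Er (O.a ω) (O.s ω) := fun ω => by
    rw [next, norm_sq_projSpace_nextQueue hn q (O.a ω) (O.s_mem ω)]
    ring
  have hprojν : projSpace n (ofMatrix ν) = uniformMatrix n :=
    projSpace_eq_uniformMatrix hn (sum_row_of_mem_doublyStochastic hν)
      (sum_col_of_mem_doublyStochastic hν)
  have h2 : inner ℝ (projSpace n (toReal q)) (ofMatrix ν) = total q / n := by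
    rw [inner_projSpace_left, hprojν, inner_uniformMatrix]; rfl
  have h3 : ∫ ω, ‖projSpace n (toReal (O.next ω))‖ ^ 2 ∂O.κ
      = (‖projSpace n (toReal q)‖ ^ 2 - 2 * ε * total q / n
          + ((2 * n - 1) / (n : ℝ) ^ 2 * ∑ p, var p + ε ^ 2)) - ∫ ω, Er (O.a ω) (O.s ω) ∂O.κ := by
    simp only [h1]
    rw [integral_sub (O.integrable_comp fun a _ => (‖projSpace n (toReal q)‖ ^ 2 - 2 * total q / n)
          + 2 * inner ℝ (projSpace n (toReal q)) (toReal a)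
          + ‖projSpace n (toReal a) - uniformMatrix n‖ ^ 2) (O.integrable_comp Er),
      integral_add (O.integrable_comp fun a _ => (‖projSpace n (toReal q)‖ ^ 2 - 2 * total q / n)
          + 2 * inner ℝ (projSpace n (toReal q)) (toReal a)) (O.integrable_comp fun a _ =>
          ‖projSpace n (toReal a) - uniformMatrix n‖ ^ 2),
      integral_add (integrable_const _) (O.integrable_comp fun a _ =>
          2 * inner ℝ (projSpace n (toReal q)) (toReal a)), integral_const_mul,
      O.integral_inner_arrival, O.integral_norm_sq_projSpace_arrival hn hν, h2]
    simp
    ring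
  rw [h3, sub_sub_cancel_left, abs_neg]
  refine abs_integral_le_integral_abs.trans ?_
  rw [← integral_const_mul, ← integral_const_mul,
    ← integral_add (f := fun ω => η * ‖perpCone (toReal (O.next ω))‖ ^ 2)
      (g := fun ω => (1 / η + 1) * total (O.idle ω))
      (O.integrable_comp fun a s => η * ‖perpCone (toReal (nextQueue q a s))‖ ^ 2)
      (O.integrable_comp fun a s => (1 / η + 1) * total (unused q a s))]
  exact integral_mono (O.integrable_comp fun a s => |Er a s|)
    (O.integrable_comp fun a s => η * ‖perpCone (toReal (nextQueue q a s))‖ ^ 2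
      + (1 / η + 1) * total (unused q a s)) fun ω => abs_unused_error_le (O.s_mem ω) hη

end OneStep

end OneStep
-- Fatou's lemma for counting measure.
theorem tsum_le_liminf_tsum {ι : Type*} {f : ℕ → ι → ℝ≥0∞} {l : ι → ℝ≥0∞}
    (h : ∀ i, Tendsto (fun t => f t i) atTop (𝓝 (l i))) :
    ∑' i, l i ≤ liminf (fun t => ∑' i, f t i) atTop := by
  rw [ENNReal.tsum_eq_iSup_sum]
  refine iSup_le fun F => ?_
  rw [← (tendsto_finsetSum F fun i _ => h i).liminf_eq]
  exact liminf_le_liminf (Eventually.of_forall fun t => ENNReal.sum_le_tsum F)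

/-! ### The switch conditioned on its state. -/

namespace SwitchSystem

variable {n : ℕ} {M : SwitchSystem.{u} n}

theorem q_succ_eq (t : ℕ) (ω : M.Ω) :
    M.q (t + 1) ω = nextQueue (M.q t ω) (M.a t ω) (M.s t ω) := by
  funext i j
  have := M.q_succ t ω i j
  simp only [nextQueue]
  omega

namespace StateChain

variable (Y : StateChain.{u, v} M)

instance : Countable Y.S := Y.countable

instance : Nonempty Y.S := (nonempty_of_isProbabilityMeasure M.μ).map (Y.X 0)

theorem measure_state_and_next (t : ℕ) (x y : Y.S) :
    M.μ ({ω | Y.X t ω = x} ∩ {ω | Y.X (t + 1) ω = y}) = M.μ {ω | Y.X t ω = x} * Y.P x y := by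
  -- The Markov property is given for whole paths, so one sums over the pasts before `t`. The
  -- default value `x` is also the prescribed state at time `t`.
  set path : (Fin t → Y.S) → ℕ → Y.S := fun h k => if hk : k < t then h ⟨k, hk⟩ else x with hpath
  have hpatht : ∀ h, path h t = x := fun h => by simp [hpath]
  set E : (Fin t → Y.S) → Set M.Ω := fun h => {ω | ∀ k ≤ t, Y.X k ω = path h k} with hE
  have hmeas : ∀ h, MeasurableSet (E h) := fun h => by
    have : E h = ⋂ k ∈ Set.Iic t, {ω | Y.X k ω = path h k} := by ext ω; simp [hE]
    rw [this]
    exact MeasurableSet.biInter (Set.to_countable _) fun k _ => Y.measurableSet_eq k _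
  have hdisj : Pairwise (Function.onFun Disjoint E) := fun h h' hne => by
    refine Set.disjoint_left.2 fun ω hω hω' => hne ?_
    funext k
    have := (hω k k.2.le).symm.trans (hω' k k.2.le)
    simpa [hpath] using this
  have hunion : {ω | Y.X t ω = x} = ⋃ h, E h := by
    ext ω
    simp only [hE, Set.mem_ofPred_eq, Set.mem_iUnion]
    constructor
    · intro hω
      refine ⟨fun k => Y.X k ω, fun k hk => ?_⟩
      rcases hk.lt_or_eq with hk | hk
      · simp [hpath, hk]
      · simpa [hpath, hk] using hω
    · rintro ⟨h, hω⟩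
      rw [hω t le_rfl, hpatht]
  rw [hunion, Set.iUnion_inter, measure_iUnion hdisj hmeas,
    measure_iUnion (fun h h' hne => (hdisj hne).mono Set.inter_subset_left Set.inter_subset_left)
      fun h => (hmeas h).inter (Y.measurableSet_eq _ _), ← ENNReal.tsum_mul_right]
  refine tsum_congr fun h => ?_
  have := Y.markov t (path h) y
  rw [hpatht] at this
  exact this

theorem measure_eq_tsum (t : ℕ) {A : Set M.Ω} (hA : MeasurableSet A) :
    M.μ A = ∑' x, M.μ (A ∩ {ω | Y.X t ω = x}) := by
  have h : (⋃ x, {ω | Y.X t ω = x}) = Set.univ := by ext ω; simp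
  rw [← measure_iUnion
    (fun x y hxy => Set.disjoint_left.2 fun ω hx hy => hxy (hx.2.symm.trans hy.2))
    fun x => hA.inter (Y.measurableSet_eq t x), ← Set.inter_iUnion, h, Set.inter_univ]

theorem measure_state_eq (t : ℕ) (y : Y.S) :
    M.μ {ω | Y.X t ω = y} = ∑' x, M.μ {ω | Y.X 0 ω = x} * stepProb Y.P t x y := by
  classical
  induction t generalizing y with
  | zero => simp [stepProb]
  | succ t ih =>
    rw [Y.measure_eq_tsum t (Y.measurableSet_eq _ _)]
    simp only [Set.inter_comm _ {ω | Y.X t ω = _}, measure_state_and_next, ih,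
      ← ENNReal.tsum_mul_right]
    rw [ENNReal.tsum_comm]
    refine tsum_congr fun x => ?_
    rw [stepProb_add, ← ENNReal.tsum_mul_left]
    exact tsum_congr fun z => by rw [stepProb_one]; ring

theorem tsum_measure_state (t : ℕ) : ∑' x, M.μ {ω | Y.X t ω = x} = 1 := by
  have := Y.measure_eq_tsum t MeasurableSet.univ
  simpa using this.symm

/-- The weight condition speaks only of states of positive probability; irreducibility makes every
state one of these at some time. -/
theorem exists_measure_state_ne_zero (hI : Irreducible Y.P) (x : Y.S) :
    ∃ t, M.μ {ω | Y.X t ω = x} ≠ 0 := by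
  obtain ⟨z, hz⟩ : ∃ z, M.μ {ω | Y.X 0 ω = z} ≠ 0 := by
    by_contra! h
    simpa [h] using Y.tsum_measure_state 0
  obtain ⟨t, ht⟩ := hI z x
  refine ⟨t, ne_of_gt ?_⟩
  rw [Y.measure_state_eq]
  exact (ENNReal.mul_pos hz ht.ne').trans_le
    (ENNReal.le_tsum (f := fun x' => M.μ {ω | Y.X 0 ω = x'} * stepProb Y.P t x' x) z)

theorem ae_cond_state (t : ℕ) (x : Y.S) :
    ∀ᵐ ω ∂ProbabilityTheory.cond M.μ {ω | Y.X t ω = x}, Y.X t ω = x :=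
  ae_cond_mem (Y.measurableSet_eq t x)

theorem lintegral_cond_next {g : Y.S → PacketMatrix n} (hg : Y.CondA2 g) {t : ℕ} {x : Y.S}
    (hx : M.μ {ω | Y.X t ω = x} ≠ 0) (F : PacketMatrix n → ℝ≥0∞) :
    ∫⁻ ω, F (M.q (t + 1) ω) ∂ProbabilityTheory.cond M.μ {ω | Y.X t ω = x}
      = kernelAct (fun a b => Y.P a b) (fun y => F (g y)) x := by
  have hcover : (⋃ y, {ω | Y.X (t + 1) ω = y}) = Set.univ := by ext ω; simp
  rw [← setLIntegral_univ, ← hcover, lintegral_iUnion (fun y => Y.measurableSet_eq (t + 1) y)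
    fun y y' hy => Set.disjoint_left.2 fun ω h h' => hy (h.symm.trans h')]
  refine tsum_congr fun y => ?_
  rw [setLIntegral_congr_fun (Y.measurableSet_eq (t + 1) y) (g := fun _ => F (g y))
    fun ω hω => by simp only [hg.1, show Y.X (t + 1) ω = y from hω], setLIntegral_const,
    cond_apply (Y.measurableSet_eq t x), measure_state_and_next,
    ← mul_assoc (M.μ {ω | Y.X t ω = x})⁻¹, ENNReal.inv_mul_cancel hx (measure_ne_top _ _), one_mul,
    mul_comm]

/-- The state is a function of the history, of which the arrivals are independent. -/
theorem map_arrival_cond (hA1 : Y.CondA1) {t : ℕ} {x : Y.S} (hx : M.μ {ω | Y.X t ω = x} ≠ 0) :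
    (ProbabilityTheory.cond M.μ {ω | Y.X t ω = x}).map (M.a t) = M.μ.map (M.a t) := by
  ext B hB
  rw [Measure.map_apply (M.measurable_a t) hB, Measure.map_apply (M.measurable_a t) hB,
    cond_apply (Y.measurableSet_eq t x),
    (Indep_iff _ _ _).1 (M.indep_history t) {ω | Y.X t ω = x} _
      (hA1.1 t (measurableSet_singleton x)) ⟨B, hB, rfl⟩,
    ← mul_assoc, ENNReal.inv_mul_cancel hx (measure_ne_top _ _), one_mul]

theorem integral_arrival_cond (hA1 : Y.CondA1) {t : ℕ} {x : Y.S}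
    (hx : M.μ {ω | Y.X t ω = x} ≠ 0) (F : PacketMatrix n → ℝ) :
    ∫ ω, F (M.a t ω) ∂ProbabilityTheory.cond M.μ {ω | Y.X t ω = x} = ∫ ω, F (M.a t ω) ∂M.μ := by
  have hF : ∀ m : Measure (PacketMatrix n), AEStronglyMeasurable F m := fun m =>
    (measurable_of_countable F).aestronglyMeasurable
  rw [← integral_map (M.measurable_a t).aemeasurable (hF _), Y.map_arrival_cond hA1 hx,
    integral_map (M.measurable_a t).aemeasurable (hF _)]

end StateChain

variable {amax : ℕ}

theorem ArrivalAssumption.integral_eq (hA : M.ArrivalAssumption amax) (t : ℕ) (i j : Fin n)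
    (f : ℕ → ℝ) : ∫ ω, f (M.a t ω i j) ∂M.μ = ∫ ω, f (M.a 0 ω i j) ∂M.μ :=
  ((hA.identDistrib i j t).comp (u := f) (measurable_of_countable f)).integral_eq

theorem ArrivalAssumption.covariance (hA : M.ArrivalAssumption amax) (t : ℕ)
    (p p' : Fin n × Fin n) :
    ∫ ω, (toReal (M.a t ω) p - M.arrivalRate p.1 p.2)
      * (toReal (M.a t ω) p' - M.arrivalRate p'.1 p'.2) ∂M.μ
      = if p = p' then M.arrivalVariance p.1 p.2 else 0 := by
  split_ifs with h
  · subst h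
    have h1 := hA.integral_eq t p.1 p.2 fun k =>
      ((k : ℝ) - M.arrivalRate p.1 p.2) * ((k : ℝ) - M.arrivalRate p.1 p.2)
    simp only [toReal_apply]
    rw [h1, arrivalVariance, variance_eq_integral]
    · simp only [sq]; rfl
    · exact ((measurable_of_countable fun a : PacketMatrix n => (a p.1 p.2 : ℝ)).comp
        (M.measurable_a 0)).aemeasurable
  · have h1 := (hA.indep_pair t p.1 p.2 p'.1 p'.2 h).comp
      (φ := fun k : ℕ => (k : ℝ) - M.arrivalRate p.1 p.2)
      (ψ := fun k : ℕ => (k : ℝ) - M.arrivalRate p'.1 p'.2)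
      (measurable_of_countable _) (measurable_of_countable _)
    have hm : ∀ f : PacketMatrix n → ℝ, AEStronglyMeasurable (fun ω => f (M.a t ω)) M.μ := fun f =>
      ((measurable_of_countable f).comp (M.measurable_a t)).aestronglyMeasurable
    have h2 := h1.integral_fun_mul_eq_mul_integral
      (hm fun a => (a p.1 p.2 : ℝ) - M.arrivalRate p.1 p.2)
      (hm fun a => (a p'.1 p'.2 : ℝ) - M.arrivalRate p'.1 p'.2)
    have h3 : ∫ ω, ((M.a t ω p.1 p.2 : ℝ) - M.arrivalRate p.1 p.2) ∂M.μ = 0 := by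
      rw [hA.integral_eq t p.1 p.2 fun k => (k : ℝ) - M.arrivalRate p.1 p.2, integral_sub,
        ← arrivalRate]
      · simp
      · refine Integrable.of_bound ((measurable_of_countable fun a : PacketMatrix n =>
          (a p.1 p.2 : ℝ)).comp (M.measurable_a 0)).aestronglyMeasurable amax
          (ae_of_all _ fun ω => ?_)
        simpa using hA.bounded 0 ω p.1 p.2
      · exact integrable_const _
    exact h2.trans (by
      change (∫ ω, ((M.a t ω p.1 p.2 : ℝ) - M.arrivalRate p.1 p.2) ∂M.μ) * _ = 0
      rw [h3, zero_mul])

/-- Given the state `x`, a slot of the switch is described by a `OneStep`. -/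
theorem StateChain.exists_oneStep (Y : StateChain.{u, v} M) (hA : M.ArrivalAssumption amax)
    {ε W : ℝ} {ν : Matrix (Fin n) (Fin n) ℝ}
    (hrate : ∀ i j, M.arrivalRate i j = (1 - ε) * ν i j) (hA1 : Y.CondA1)
    {g : Y.S → PacketMatrix n} (hA2 : Y.CondA2 g) (hW : Y.NearMaxWeight g W) (x : Y.S) :
    ∃ O : OneStep M.Ω (g x) amax W ε ν (fun p => M.arrivalVariance p.1 p.2),
      ∀ F : PacketMatrix n → ℝ≥0∞,
        kernelAct (fun a b => Y.P a b) (fun y => F (g y)) x = ∫⁻ ω, F (O.next ω) ∂O.κ := by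
  -- Any slot in which `x` has positive probability will do: by homogeneity the transition law does
  -- not depend on it.
  obtain ⟨t, ht⟩ := Y.exists_measure_state_ne_zero hA1.2.1 x
  have hq : ∀ᵐ ω ∂ProbabilityTheory.cond M.μ {ω | Y.X t ω = x}, M.q t ω = g x := by
    filter_upwards [Y.ae_cond_state t x] with ω hω
    rw [hA2.1, hω]
  refine ⟨{
    κ := ProbabilityTheory.cond M.μ {ω | Y.X t ω = x}
    isProb := cond_isProbabilityMeasure ht
    a := M.a t
    s := M.s t
    measurable_a := M.measurable_a t
    measurable_s := M.measurable_s t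
    s_mem := M.s_mem t
    a_le := hA.bounded t
    mean := fun p => ?_
    cov := fun p p' => ?_
    maxWeight_le := ?_ }, fun F => ?_⟩
  · rw [Y.integral_arrival_cond hA1 ht fun a => toReal a p]
    exact (hA.integral_eq t p.1 p.2 fun k => (k : ℝ)).trans (hrate p.1 p.2)
  · have hr : ∀ p : Fin n × Fin n, (1 - ε) * ofMatrix ν p = M.arrivalRate p.1 p.2 :=
      fun p => (hrate p.1 p.2).symm
    rw [hr, hr, Y.integral_arrival_cond hA1 ht fun a =>
      (toReal a p - M.arrivalRate p.1 p.2) * (toReal a p' - M.arrivalRate p'.1 p'.2)]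
    exact hA.covariance t p p'
  · refine (hW t x ht).trans (le_of_eq (integral_congr_ae ?_))
    filter_upwards [hq] with ω hω
    rw [hω]
  · rw [← Y.lintegral_cond_next hA2 ht]
    refine lintegral_congr_ae ?_
    filter_upwards [hq] with ω hω
    rw [q_succ_eq, hω]
    rfl

end SwitchSystem
theorem pow_le_factorial_div_mul_exp {θ x : ℝ} (hθ : 0 < θ) (hx : 0 ≤ x) (r : ℕ) :
    x ^ r ≤ r.factorial / θ ^ r * Real.exp (θ * x) := by
  have h := Real.pow_div_factorial_le_exp (θ * x) (by positivity) r
  rw [mul_pow, div_le_iff₀ (by positivity)] at h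
  rw [div_mul_eq_mul_div, le_div_iff₀ (by positivity)]
  linarith

/-! ### The stationary law as a measure and the limit in distribution. -/

namespace SwitchSystem.StateChain

variable {n : ℕ} {M : SwitchSystem.{u} n} (Y : StateChain.{u, v} M)

instance : MeasurableSpace Y.S := ⊤

instance : DiscreteMeasurableSpace Y.S := ⟨fun _ => trivial⟩

/-- The measure with point masses `L`. -/
noncomputable def stateLaw (L : Y.S → ℝ≥0∞) : Measure Y.S :=
  Measure.sum fun x => L x • Measure.dirac x

theorem lintegral_stateLaw (L F : Y.S → ℝ≥0∞) :
    ∫⁻ x, F x ∂Y.stateLaw L = ∑' x, L x * F x := by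
  simp [stateLaw, lintegral_sum_measure, lintegral_smul_measure]

variable {Y} {L : Y.S → ℝ≥0∞} {g : Y.S → PacketMatrix n}

theorem isProbabilityMeasure_stateLaw (h1 : ∑' x, L x = 1) :
    IsProbabilityMeasure (Y.stateLaw L) :=
  ⟨by rw [← lintegral_one, lintegral_stateLaw]; simpa using h1⟩

theorem integrable_of_lintegral_ne_top {f : Y.S → ℝ} (hf : ∀ x, 0 ≤ f x)
    (h : ∑' x, L x * ENNReal.ofReal (f x) ≠ ∞) : Integrable f (Y.stateLaw L) := by
  refine ⟨Measurable.of_discrete.aestronglyMeasurable, ?_⟩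
  rw [hasFiniteIntegral_iff_ofReal (ae_of_all _ hf), lintegral_stateLaw]
  exact h.lt_top

theorem integral_stateLaw {f : Y.S → ℝ} (hf : ∀ x, 0 ≤ f x) :
    ∫ x, f x ∂Y.stateLaw L = (∑' x, L x * ENNReal.ofReal (f x)).toReal := by
  rw [integral_eq_lintegral_of_nonneg_ae (ae_of_all _ hf)
    Measurable.of_discrete.aestronglyMeasurable, lintegral_stateLaw]

theorem tsum_ne_top_of_integrable {f : Y.S → ℝ} (hf : ∀ x, 0 ≤ f x)
    (h : Integrable f (Y.stateLaw L)) : ∑' x, L x * ENNReal.ofReal (f x) ≠ ∞ := by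
  have := h.2
  rw [hasFiniteIntegral_iff_ofReal (ae_of_all _ hf), lintegral_stateLaw] at this
  exact this.ne

/-- Stationarity is an identity of possibly infinite sums; integrability of `f` makes it one of
reals, so that drifts have mean zero. -/
theorem integrable_and_integral_eq_of_kernelAct (hL : IsLimitLaw Y.P L) (h1 : ∑' x, L x = 1)
    {f Pf : Y.S → ℝ} (hf : ∀ x, 0 ≤ f x) (hPf : ∀ x, 0 ≤ Pf x)
    (h : ∀ x, ENNReal.ofReal (Pf x)
      = kernelAct (fun a b => Y.P a b) (fun y => ENNReal.ofReal (f y)) x)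
    (hinteg : Integrable f (Y.stateLaw L)) :
    Integrable Pf (Y.stateLaw L) ∧ ∫ x, Pf x ∂Y.stateLaw L = ∫ x, f x ∂Y.stateLaw L := by
  have h2 : ∑' x, L x * ENNReal.ofReal (Pf x) = ∑' x, L x * ENNReal.ofReal (f x) := by
    simp only [h]
    exact hL.tsum_mul_kernelAct h1 _
  refine ⟨integrable_of_lintegral_ne_top hPf ?_, ?_⟩
  · rw [h2]; exact tsum_ne_top_of_integrable hf hinteg
  · rw [integral_stateLaw hPf, integral_stateLaw hf, h2]

/-- By the portmanteau theorem a lower bound on open sets suffices. Fatou gives it, summing over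
pairs of an initial and a current state. -/
theorem isSteadyState (hL : IsLimitLaw Y.P L) (hA2 : Y.CondA2 g)
    (Q : ProbabilityMeasure (PacketMatrix n))
    (hQ : (Q : Measure (PacketMatrix n)) = (Y.stateLaw L).map g) : M.IsSteadyState Q := by
  classical
  refine ⟨fun t => (M.measurable_q t).aemeasurable, aemeasurable_id, ?_⟩
  refine tendsto_of_forall_isOpen_le_liminf' fun G _ => ?_
  have hG : MeasurableSet G := MeasurableSet.of_discrete
  change (Measure.map id (Q : Measure (PacketMatrix n))) G
    ≤ liminf (fun t => (M.μ.map (M.q t)) G) atTop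
  set I : Y.S → ℝ≥0∞ := fun y => if g y ∈ G then 1 else 0 with hI
  have hleft : (Measure.map id (Q : Measure (PacketMatrix n))) G
      = ∑' p : Y.S × Y.S, M.μ {ω | Y.X 0 ω = p.1} * L p.2 * I p.2 := by
    rw [Measure.map_id, hQ, Measure.map_apply Measurable.of_discrete hG,
      ← lintegral_indicator_one (MeasurableSet.of_discrete), lintegral_stateLaw, ENNReal.tsum_prod']
    simp only [mul_assoc, ENNReal.tsum_mul_left]
    rw [ENNReal.tsum_mul_right, Y.tsum_measure_state 0, one_mul]
    exact tsum_congr fun x => by simp [hI, Set.indicator_apply]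
  have hright : ∀ t, (M.μ.map (M.q t)) G
      = ∑' p : Y.S × Y.S, M.μ {ω | Y.X 0 ω = p.1} * stepProb Y.P t p.1 p.2 * I p.2 := fun t => by
    rw [Measure.map_apply (M.measurable_q t) hG, Y.measure_eq_tsum t (M.measurable_q t hG),
      ENNReal.tsum_prod', ENNReal.tsum_comm]
    refine tsum_congr fun y => ?_
    dsimp only
    rw [ENNReal.tsum_mul_right, ← Y.measure_state_eq]
    by_cases hy : g y ∈ G
    · rw [Set.inter_eq_right.2 fun ω hω => by
        change M.q t ω ∈ G
        rw [hA2.1, show Y.X t ω = y from hω]; exact hy]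
      simp [hI, hy]
    · have : M.q t ⁻¹' G ∩ {ω | Y.X t ω = y} = ∅ := by
        refine Set.eq_empty_of_forall_notMem fun ω hω => hy ?_
        have h2 : M.q t ω ∈ G := hω.1
        rwa [hA2.1, show Y.X t ω = y from hω.2] at h2
      simp [hI, hy, this]
  simp only [hleft, hright]
  refine tsum_le_liminf_tsum fun p => ?_
  exact ENNReal.Tendsto.mul_const (ENNReal.Tendsto.const_mul (hL p.1 p.2)
    (Or.inr (measure_ne_top _ _))) (Or.inr (by simp only [hI]; split_ifs <;> simp))

end SwitchSystem.StateChain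

open SwitchSystem SwitchSystem.StateChain

/-! ### Steady-state moments and the heavy-traffic identity. -/

section HeavyTraffic

variable {n amax : ℕ} {M : SwitchSystem.{u} n} {Y : StateChain.{u, v} M} {W ε : ℝ}
  {ν : Matrix (Fin n) (Fin n) ℝ} {var : Fin n × Fin n → ℝ} {g : Y.S → PacketMatrix n}

/-- A family of `OneStep`s that describes the transitions of the chain. -/
def Describes (O : ∀ x : Y.S, OneStep M.Ω (g x) amax W ε ν var) : Prop :=
  ∀ x (F : PacketMatrix n → ℝ≥0∞),
    kernelAct (fun a b => Y.P a b) (fun y => F (g y)) x = ∫⁻ ω, F ((O x).next ω) ∂(O x).κ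

variable {O : ∀ x : Y.S, OneStep M.Ω (g x) amax W ε ν var} {L : Y.S → ℝ≥0∞}

theorem Describes.geometricDrift (hO : Describes O) {θ D δ c : ℝ} {γ b : ℝ≥0}
    (hexp : ∀ (Ω : Type u) [MeasurableSpace Ω] (κ : Measure Ω)
      [IsProbabilityMeasure κ] (Z : Ω → ℝ) (v : ℝ), Measurable Z → (∀ ω, |Z ω - v| ≤ D) →
      ∫ ω, Z ω ^ 2 ∂κ ≤ v ^ 2 - δ * v + c →
      ∫⁻ ω, ENNReal.ofReal (Real.exp (θ * Z ω)) ∂κ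
        ≤ γ * ENNReal.ofReal (Real.exp (θ * v)) + b)
    (N : PacketMatrix n → ℝ) (hN : ∀ x ω, |N ((O x).next ω) - N (g x)| ≤ D)
    (hdrift : ∀ x, ∫ ω, N ((O x).next ω) ^ 2 ∂(O x).κ ≤ N (g x) ^ 2 - δ * N (g x) + c) :
    GeometricDrift Y.P (fun x => (Real.exp (θ * N (g x))).toNNReal) γ b := by
  intro x
  have h := hexp M.Ω (O x).κ (fun ω => N ((O x).next ω)) (N (g x))
    ((O x).measurable_comp fun a s => N (nextQueue (g x) a s)) (hN x) (hdrift x)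
  rw [← hO x fun q => ENNReal.ofReal (Real.exp (θ * N q))] at h
  exact h

theorem Describes.integrable_and_integral_eq (hO : Describes O) (hL : IsLimitLaw Y.P L)
    (h1 : ∑' x, L x = 1) {f : PacketMatrix n → ℝ} (hf : ∀ q, 0 ≤ f q)
    (hinteg : Integrable (fun x => f (g x)) (Y.stateLaw L)) :
    Integrable (fun x => ∫ ω, f ((O x).next ω) ∂(O x).κ) (Y.stateLaw L) ∧
      ∫ x, (∫ ω, f ((O x).next ω) ∂(O x).κ) ∂Y.stateLaw L = ∫ x, f (g x) ∂Y.stateLaw L := by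
  refine integrable_and_integral_eq_of_kernelAct hL h1 (fun x => hf (g x))
    (fun x => integral_nonneg fun ω => hf _) (fun x => ?_) hinteg
  rw [hO x fun q => ENNReal.ofReal (f q)]
  exact ofReal_integral_eq_lintegral_ofReal
    ((O x).integrable_comp fun a s => f (nextQueue (g x) a s)) (ae_of_all _ fun ω => hf _)

/-- The chain has a limit law, under which the queue lengths have an exponential moment. -/
theorem Describes.exists_isLimitLaw (hO : Describes O) (hn : 0 < n) (hA1 : Y.CondA1)
    (hA2 : Y.CondA2 g) (hε : 0 < ε) (hν : ν ∈ doublyStochastic ℝ (Fin n)) {δ : ℝ} (hδ : 0 < δ)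
    (hδν : ∀ i j, δ ≤ ν i j) :
    ∃ L, IsLimitLaw Y.P L ∧ ∑' x, L x = 1 ∧ ∃ θ : ℝ, 0 < θ ∧
      ∑' x, L x * ENNReal.ofReal (Real.exp (θ * ‖toReal (g x)‖)) ≠ ∞ := by
  have hD : (0 : ℝ) < n * (amax + 1 : ℝ) := by positivity
  obtain ⟨θ, hθ, γ, b, hγ, hexp⟩ := exists_exp_drift.{u} hD (show 0 < 2 * ε * δ by positivity)
    (2 * W + (n * (amax + 1 : ℝ)) ^ 2)
  have hV := hO.geometricDrift hexp (fun q => ‖toReal q‖)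
    (fun x ω => (abs_norm_sub_norm_le _ _).trans
      (norm_nextQueue_sub_le (g x) ((O x).a_le ω) ((O x).s_mem ω)))
    (fun x => (O x).integral_norm_sq_next_le hν hδν hε.le hδ.le)
  -- As `θ‖q‖ ≤ exp (θ‖q‖)`, the entries of `q` are at most `R/θ`, and A.2 leaves finitely many
  -- states.
  have hfin : ∀ R, {x | (Real.exp (θ * ‖toReal (g x)‖)).toNNReal ≤ R}.Finite := fun R => by
    have hsub : {x | (Real.exp (θ * ‖toReal (g x)‖)).toNNReal ≤ R}
        ⊆ g ⁻¹' Set.Iic (fun _ _ => ⌈(R : ℝ) / θ⌉₊) := by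
      intro x hx i j
      have h2 : Real.exp (θ * ‖toReal (g x)‖) ≤ R := Real.toNNReal_le_iff_le_coe.1 hx
      have h3 : ((g x i j : ℕ) : ℝ) ≤ ‖toReal (g x)‖ := by
        simpa using PiLp.norm_apply_le (toReal (g x)) (i, j)
      have h4 := Real.add_one_le_exp (θ * ‖toReal (g x)‖)
      have h5 : ((g x i j : ℕ) : ℝ) ≤ R / θ := by
        rw [le_div_iff₀ hθ]
        nlinarith
      exact_mod_cast h5.trans (Nat.le_ceil _)
    exact (hA2.2 _ (Set.finite_Iic _)).subset hsub
  obtain ⟨L, hL⟩ := InputQueuedSwitch.exists_isLimitLaw hA1.2.1 hA1.2.2 hγ hV hfin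
  obtain ⟨c, hc, -⟩ := exists_drift_fixed_point hγ b
  exact ⟨L, hL, hL.tsum_eq_one hγ hV hfin, θ, hθ,
    ne_top_of_le_ne_top ENNReal.coe_ne_top (hL.tsum_mul_le_of_drift hγ hV hc)⟩

/-- Moments are bounded by exponential moments. -/
theorem integrable_pow_and_integral_le {N : Y.S → ℝ} (hN : ∀ x, 0 ≤ N x) {θ : ℝ} (hθ : 0 < θ)
    {c : ℝ≥0} (h : ∑' x, L x * ENNReal.ofReal (Real.exp (θ * N x)) ≤ c) (r : ℕ) :
    Integrable (fun x => N x ^ r) (Y.stateLaw L) ∧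
      ∫ x, N x ^ r ∂Y.stateLaw L ≤ r.factorial / θ ^ r * c := by
  have hexp : Integrable (fun x => Real.exp (θ * N x)) (Y.stateLaw L) :=
    integrable_of_lintegral_ne_top (fun x => (Real.exp_pos _).le)
      (ne_top_of_le_ne_top ENNReal.coe_ne_top h)
  have hpow : Integrable (fun x => N x ^ r) (Y.stateLaw L) :=
    (hexp.const_mul (r.factorial / θ ^ r)).mono' Measurable.of_discrete.aestronglyMeasurable
      (ae_of_all _ fun x => by
        rw [Real.norm_of_nonneg (pow_nonneg (hN x) r)]
        exact pow_le_factorial_div_mul_exp hθ (hN x) r)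
  refine ⟨hpow, ?_⟩
  calc _ ≤ ∫ x, r.factorial / θ ^ r * Real.exp (θ * N x) ∂Y.stateLaw L :=
        integral_mono hpow (hexp.const_mul _) fun x => pow_le_factorial_div_mul_exp hθ (hN x) r
    _ ≤ _ := by
        rw [integral_const_mul, integral_stateLaw fun x => (Real.exp_pos _).le]
        gcongr
        exact ENNReal.toReal_le_coe_of_le_coe h

/-- In steady state the mean total queue length is determined up to the unused service and the
distance to the cone. -/
theorem Describes.abs_mean_total_sub_le (hO : Describes O) (hL : IsLimitLaw Y.P L)
    (h1 : ∑' x, L x = 1) (hn : 0 < n) (hν : ν ∈ doublyStochastic ℝ (Fin n))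
    (hT : Integrable (fun x => total (g x)) (Y.stateLaw L))
    (hT2 : Integrable (fun x => ‖toReal (g x)‖ ^ 2) (Y.stateLaw L)) {η : ℝ} (hη : 0 < η) :
    |2 * ε * (∫ x, total (g x) ∂Y.stateLaw L) / n
        - ((2 * n - 1) / (n : ℝ) ^ 2 * ∑ p, var p + ε ^ 2)|
      ≤ η * ∫ x, ‖perpCone (toReal (g x))‖ ^ 2 ∂Y.stateLaw L + (1 / η + 1) * (n * ε) := by
  have := isProbabilityMeasure_stateLaw h1
  have hdom : ∀ f : Y.S → ℝ, (∀ x, 0 ≤ f x) → (∀ x, f x ≤ ‖toReal (g x)‖ ^ 2) →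
      Integrable f (Y.stateLaw L) := fun f hf hle =>
    hT2.mono' Measurable.of_discrete.aestronglyMeasurable (ae_of_all _ fun x => by
      rw [Real.norm_of_nonneg (hf x)]; exact hle x)
  have hh : Integrable (fun x => ‖projSpace n (toReal (g x))‖ ^ 2) (Y.stateLaw L) :=
    hdom _ (fun x => by positivity) fun x => by gcongr; exact norm_projSpace_le _
  have hN : Integrable (fun x => ‖perpCone (toReal (g x))‖ ^ 2) (Y.stateLaw L) :=
    hdom _ (fun x => by positivity) fun x => by
      rw [norm_sq_eq_projCone_add_perpCone (toReal (g x))]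
      linarith [sq_nonneg ‖projCone (toReal (g x))‖]
  obtain ⟨hPT, hPT'⟩ := hO.integrable_and_integral_eq hL h1 (f := total) total_nonneg hT
  obtain ⟨hPh, hPh'⟩ := hO.integrable_and_integral_eq hL h1
    (f := fun q => ‖projSpace n (toReal q)‖ ^ 2) (fun q => by positivity) hh
  obtain ⟨hPN, hPN'⟩ := hO.integrable_and_integral_eq hL h1
    (f := fun q => ‖perpCone (toReal q)‖ ^ 2) (fun q => by positivity) hN
  have hUeq : ∀ x, ∫ ω, total ((O x).idle ω) ∂(O x).κ
      = ∫ ω, total ((O x).next ω) ∂(O x).κ - total (g x) + n * ε := fun x => by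
    rw [(O x).integral_total_next hν]; ring
  have hPTT : Integrable (fun x => ∫ ω, total ((O x).next ω) ∂(O x).κ - total (g x))
      (Y.stateLaw L) := hPT.sub hT
  have hU : Integrable (fun x => ∫ ω, total ((O x).idle ω) ∂(O x).κ) (Y.stateLaw L) := by
    simp only [hUeq]
    exact hPTT.add (integrable_const _)
  have hUint : ∫ x, (∫ ω, total ((O x).idle ω) ∂(O x).κ) ∂Y.stateLaw L = n * ε := by
    simp only [hUeq]
    rw [integral_add hPTT (integrable_const _), integral_sub hPT hT, hPT']
    simp
  set cst : ℝ := (2 * n - 1) / (n : ℝ) ^ 2 * ∑ p, var p + ε ^ 2 with hcst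
  set Ph : Y.S → ℝ := fun x => ∫ ω, ‖projSpace n (toReal ((O x).next ω))‖ ^ 2 ∂(O x).κ with hPhdef
  have hlin : Integrable (fun x => 2 * ε / n * total (g x)) (Y.stateLaw L) := hT.const_mul _
  have hPhh : Integrable (fun x => Ph x - ‖projSpace n (toReal (g x))‖ ^ 2) (Y.stateLaw L) :=
    hPh.sub hh
  have hPhl : Integrable (fun x => Ph x - ‖projSpace n (toReal (g x))‖ ^ 2
      + 2 * ε / n * total (g x)) (Y.stateLaw L) := hPhh.add hlin
  -- The drift of `‖projSpace q‖²` has mean zero, so only the linear term and the constant survive.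
  have hE : ∫ x, (Ph x - ‖projSpace n (toReal (g x))‖ ^ 2
        + 2 * ε / n * total (g x) - cst) ∂Y.stateLaw L
      = 2 * ε * (∫ x, total (g x) ∂Y.stateLaw L) / n - cst := by
    rw [integral_sub hPhl (integrable_const _),
      integral_add hPhh hlin, integral_sub hPh hh, hPh', integral_const_mul]
    simp
    ring
  rw [← hE]
  refine abs_integral_le_integral_abs.trans ?_
  rw [← hPN', ← hUint, ← integral_const_mul, ← integral_const_mul,
    ← integral_add (hPN.const_mul η) (hU.const_mul _)]
  refine integral_mono (hPhl.sub (integrable_const _)).abs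
    ((hPN.const_mul η).add (hU.const_mul _)) fun x => ?_
  refine le_trans (le_of_eq ?_)
    ((O x).abs_integral_norm_sq_projSpace_next_sub_le hn hν hη)
  simp only [hPhdef]
  congr 1
  ring

end HeavyTraffic
theorem tendsto_heavyTraffic : Tendsto (fun ε : Param => (ε : ℝ)) heavyTraffic (𝓝 0) :=
  tendsto_comap.mono_right nhdsWithin_le_nhds

/-- If `2 ε T ε / n` is close to the variance term, then `ε T ε` has the heavy-traffic limit. -/
theorem tendsto_mean_of_abs_sub_le {n : ℕ} (hn : 0 < n) {T : Param → ℝ}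
    {v : Param → Fin n → Fin n → ℝ} {σsq : Fin n → Fin n → ℝ} {C ε₀ : ℝ} (hε₀ : 0 < ε₀)
    (hv : ∀ i j, Tendsto (fun ε => v ε i j) heavyTraffic (𝓝 (σsq i j)))
    (h : ∀ ε : Param, (ε : ℝ) ≤ ε₀ →
      |2 * ε * T ε / n
          - ((2 * n - 1) / (n : ℝ) ^ 2 * ∑ p : Fin n × Fin n, v ε p.1 p.2 + (ε : ℝ) ^ 2)|
        ≤ √(ε : ℝ) * C + (1 / √(ε : ℝ) + 1) * (n * ε)) :
    Tendsto (fun ε : Param => (ε : ℝ) * T ε) heavyTraffic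
      (𝓝 ((1 - 1 / (2 * (n : ℝ))) * ∑ i, ∑ j, σsq i j)) := by
  have hn' : (n : ℝ) ≠ 0 := by positivity
  have hsqrt : Tendsto (fun ε : Param => √(ε : ℝ)) heavyTraffic (𝓝 0) := by
    simpa using tendsto_heavyTraffic.sqrt
  have hbound : Tendsto (fun ε : Param => √(ε : ℝ) * C + (√(ε : ℝ) * n + n * ε)) heavyTraffic
      (𝓝 0) := by
    simpa using (hsqrt.mul_const C).add
      ((hsqrt.mul_const (n : ℝ)).add (tendsto_heavyTraffic.const_mul (n : ℝ)))
  have hdiff : Tendsto (fun ε : Param => 2 * ε * T ε / n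
      - ((2 * n - 1) / (n : ℝ) ^ 2 * ∑ p : Fin n × Fin n, v ε p.1 p.2 + (ε : ℝ) ^ 2))
      heavyTraffic (𝓝 0) := by
    refine squeeze_zero_norm' ?_ hbound
    filter_upwards [tendsto_heavyTraffic.eventually (eventually_le_nhds hε₀)] with ε hε
    rw [Real.norm_eq_abs]
    refine (h ε hε).trans (le_of_eq ?_)
    have hpos : 0 < √(ε : ℝ) := Real.sqrt_pos.2 ε.2.1
    have hsq : √(ε : ℝ) * √(ε : ℝ) = ε := Real.mul_self_sqrt ε.2.1.le
    have : 1 / √(ε : ℝ) * (n * ε) = √(ε : ℝ) * n := by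
      rw [one_div, inv_mul_eq_iff_eq_mul₀ hpos.ne']
      linear_combination (-(n : ℝ)) * hsq
    linear_combination this
  have hvar : Tendsto (fun ε : Param => (2 * n - 1) / (n : ℝ) ^ 2
      * ∑ p : Fin n × Fin n, v ε p.1 p.2 + (ε : ℝ) ^ 2) heavyTraffic
      (𝓝 ((2 * n - 1) / (n : ℝ) ^ 2 * ∑ p : Fin n × Fin n, σsq p.1 p.2 + 0 ^ 2)) :=
    ((tendsto_finsetSum _ fun p _ => hv p.1 p.2).const_mul _).add (tendsto_heavyTraffic.pow 2)
  -- The factor `n/2` undoes `2/n` and turns `(2n-1)/n²` into `1 - 1/(2n)`.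
  have hlim := (hdiff.add hvar).const_mul ((n : ℝ) / 2)
  rw [Fintype.sum_prod_type] at hlim
  convert hlim using 2
  · field_simp
    ring
  · field_simp
    ring

end InputQueuedSwitch

/-! ### The theorem: choice of constants. -/

open InputQueuedSwitch InputQueuedSwitch.SwitchSystem.StateChain in
theorem mainTheorem2 (n : ℕ) (hn : 0 < n) (amax : ℕ)
    (ν : Matrix (Fin n) (Fin n) ℝ) (hν : ν ∈ doublyStochastic ℝ (Fin n))
    (hνpos : ∀ i j, 0 < ν i j) (σsq : Fin n → Fin n → ℝ)
    (M : InputQueuedSwitch.Param → InputQueuedSwitch.SwitchSystem.{u} n)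
    (hA : ∀ ε, (M ε).ArrivalAssumption amax)
    (hrate : ∀ ε i j, (M ε).arrivalRate i j = (1 - (ε : ℝ)) * ν i j)
    (hvar : ∀ i j, Filter.Tendsto (fun ε => (M ε).arrivalVariance i j)
      InputQueuedSwitch.heavyTraffic (nhds (σsq i j)))
    (Y : ∀ ε, InputQueuedSwitch.SwitchSystem.StateChain.{u, v} (M ε))
    (hY : InputQueuedSwitch.ClassTwo M Y) :
    InputQueuedSwitch.AchievesSSC M Y ∧ InputQueuedSwitch.MaxWeightLike M σsq := by
  obtain ⟨W, -, hW⟩ := hY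
  choose hA1 g hA2 hnear using hW
  obtain ⟨δ, hδ, hδν⟩ : ∃ δ > 0, ∀ i j, δ ≤ ν i j := by
    have : Nonempty (Fin n × Fin n) := ⟨⟨⟨0, hn⟩, ⟨0, hn⟩⟩⟩
    obtain ⟨p, hp⟩ := Finite.exists_min fun p : Fin n × Fin n => ν p.1 p.2
    exact ⟨ν p.1 p.2, hνpos _ _, fun i j => hp (i, j)⟩
  choose O hO using fun ε => fun x =>
    (Y ε).exists_oneStep (hA ε) (hrate ε) (hA1 ε) (hA2 ε) (hnear ε) x
  have hdesc : ∀ ε, Describes (O ε) := fun ε x F => hO ε x F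
  -- The exponents `θ₀` depend on `ε`; they serve only for finiteness of moments.
  choose L hL hL1 θ₀ hθ₀ hmom using fun ε : Param =>
    (hdesc ε).exists_isLimitLaw hn (hA1 ε) (hA2 ε) ε.2.1 hν hδ hδν
  have hD : (0 : ℝ) < n * (amax + 1 : ℝ) := by positivity
  -- These constants are fixed before `ε`, which makes the moment bounds uniform.
  obtain ⟨θ, hθ, γ, b, hγ, hexp⟩ := exists_exp_drift.{u} hD hδ
    (2 * W + (n * (amax + 1 : ℝ)) ^ 2)
  obtain ⟨c, hc, -⟩ := exists_drift_fixed_point hγ b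
  have hprob : ∀ ε, IsProbabilityMeasure (((Y ε).stateLaw (L ε)).map (g ε)) := fun ε =>
    have := isProbabilityMeasure_stateLaw (hL1 ε)
    Measure.isProbabilityMeasure_map Measurable.of_discrete.aemeasurable
  set Q : Param → ProbabilityMeasure (PacketMatrix n) := fun ε => ⟨_, hprob ε⟩ with hQ
  have hQ' : ∀ ε, (Q ε : Measure (PacketMatrix n)) = ((Y ε).stateLaw (L ε)).map (g ε) :=
    fun ε => rfl
  have hsteady : ∀ ε, (M ε).IsSteadyState (Q ε) := fun ε =>
    isSteadyState (hL ε) (hA2 ε) (Q ε) (hQ' ε)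
  have hgm : ∀ ε, AEMeasurable (g ε) ((Y ε).stateLaw (L ε)) := fun ε =>
    Measurable.of_discrete.aemeasurable
  have hinteg : ∀ ε (f : PacketMatrix n → ℝ), Integrable f (Q ε : Measure (PacketMatrix n)) ↔
      Integrable (fun x => f (g ε x)) ((Y ε).stateLaw (L ε)) := fun ε f => by
    rw [hQ', integrable_map_measure Measurable.of_discrete.aestronglyMeasurable (hgm ε)]
    rfl
  have hintegral : ∀ ε (f : PacketMatrix n → ℝ), ∫ q, f q ∂(Q ε : Measure (PacketMatrix n))
      = ∫ x, f (g ε x) ∂(Y ε).stateLaw (L ε) := fun ε f => by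
    rw [hQ', integral_map (hgm ε) Measurable.of_discrete.aestronglyMeasurable]
  -- Chosen so that `ε ‖ν‖ ≤ δ/2`; the `+ 1` avoids a division by zero.
  set ε₀ : ℝ := δ / (2 * (‖ofMatrix ν‖ + 1)) with hε₀def
  have hε₀ : 0 < ε₀ := by positivity
  have hperp : ∀ ε : Param, (ε : ℝ) ≤ ε₀ → ∀ r : ℕ,
      Integrable (fun x => ‖perpCone (toReal (g ε x))‖ ^ r) ((Y ε).stateLaw (L ε)) ∧
        ∫ x, ‖perpCone (toReal (g ε x))‖ ^ r ∂(Y ε).stateLaw (L ε)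
          ≤ r.factorial / θ ^ r * c := by
    intro ε hε r
    have hsmall : (ε : ℝ) * ‖ofMatrix ν‖ ≤ δ / 2 := by
      calc (ε : ℝ) * ‖ofMatrix ν‖ ≤ ε₀ * (‖ofMatrix ν‖ + 1) := by
            gcongr
            linarith
        _ = δ / 2 := by rw [hε₀def]; field_simp
    have hV := (hdesc ε).geometricDrift hexp (fun q => ‖perpCone (toReal q)‖)
      (fun x ω => (abs_norm_perpCone_sub_le _ _).trans
        (norm_nextQueue_sub_le (g ε x) ((O ε x).a_le ω) ((O ε x).s_mem ω)))
      (fun x => (O ε x).integral_norm_sq_perpCone_next_le hν hδ.le hδν ε.2.1.le hsmall)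
    exact integrable_pow_and_integral_le (fun x => norm_nonneg _) hθ
      ((hL ε).tsum_mul_le_of_drift hγ hV hc) r
  have hnorm : ∀ ε (r : ℕ),
      Integrable (fun x => ‖toReal (g ε x)‖ ^ r) ((Y ε).stateLaw (L ε)) := fun ε r =>
    (integrable_pow_and_integral_le (fun x => norm_nonneg _) (hθ₀ ε)
      (ENNReal.coe_toNNReal (hmom ε)).ge r).1
  have htotal : ∀ ε, Integrable (fun x => total (g ε x)) ((Y ε).stateLaw (L ε)) := fun ε => by
    refine ((hnorm ε 1).const_mul ((n : ℝ) * n)).mono' Measurable.of_discrete.aestronglyMeasurable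
      (ae_of_all _ fun x => ?_)
    rw [Real.norm_of_nonneg (total_nonneg _), total]
    calc _ ≤ ∑ _i : Fin n, ∑ _j : Fin n, ‖toReal (g ε x)‖ := by
          gcongr with i _ j _
          simpa using PiLp.norm_apply_le (toReal (g ε x)) (i, j)
      _ = _ := by simp; ring
  refine ⟨⟨fun ε => (hL ε).positiveRecurrent ((hL ε).pos (hL1 ε) (hA1 ε).2.1),
    fun ε => ⟨hA1 ε, g ε, hA2 ε⟩, Q, hsteady, ε₀, hε₀, fun r => r.factorial / θ ^ r * c,
    fun ε hε r _ => ⟨?_, ?_⟩⟩, Q, hsteady, fun ε => ?_, ?_⟩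
  · exact (hinteg ε _).2 (hperp ε hε r).1
  · rw [hintegral ε fun q => ‖perpCone (toReal q)‖ ^ r]
    exact (hperp ε hε r).2
  · exact (hinteg ε total).2 (htotal ε)
  · simp only [hintegral _ fun q => ∑ i, ∑ j, (q i j : ℝ)]
    refine tendsto_mean_of_abs_sub_le (C := (2).factorial / θ ^ 2 * c) hn hε₀ hvar fun ε hε => ?_
    -- Here `η = √ε` balances `η` against `ε/η`.
    refine ((hdesc ε).abs_mean_total_sub_le (hL ε) (hL1 ε) hn hν (htotal ε) (hnorm ε 2)
      (Real.sqrt_pos.2 ε.2.1)).trans ?_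
    gcongr
    exact (hperp ε hε 2).2
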